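/- Let $R\ge 2$ be an integer. Bubbles. A $d$-bubble $\mathcal B$ is a finite loopless multigraph whose edges carry one of $d$ colours, each colour being incident exactly once at each vertex; $c(\mathcal B)$ is its number of connected components. For a cyclic permutation $\sigma$ of the $d$ colours, the jacket $\mathcal J(\mathcal B;\sigma)$ is the ribbon graph with underlying graph $\mathcal B$, given by the following signed rotation system: choose a partition of the vertices into filled and unfilled ones, order the coloured edges according to $\sigma$ around each unfilled vertex and according to $\sigma^{-1}$ around each filled vertex, and give the signature $-1$ (twisted) to the edges joining two vertices of the same type and $+1$ to the other ones; the result does not depend on the partition, up to equivalence. Its genus $g(\mathcal B;\sigma)$ is defined by $2c-2g=V-E+F$, with $F$ the number of faces (boundary components) of the ribbon graph. The degree is $\deg\mathcal B=\frac12\sum_{\sigma}g(\mathcal B;\sigma)$, the sum being over all the cyclic permutations $\sigma$ of the $d$ colours. For an $(R+1)$-bubble $\mathcal B$ with colours $0,1,\dots,R$, let $\mathcal B^{(0)}$ be the $R$-bubble obtained by deleting the edges of colour $0$, and let $$\mathrm{ind}_0\,\mathcal B=\frac{1}{(R-2)!}\bigl(\deg\mathcal B-R\,\deg\mathcal B^{(0)}\bigr).$$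 Model. Let $(\mathcal B_a)_{a\in\mathcal S}$ be a family of $R$-bubbles with colours $1,\dots,R$, not necessarily connected, and let $\mathcal I_{\mathcal B_a}(T)$ be the associated trace invariants of a real tensor $T=(T_{a_1\cdots a_R})_{1\le a_i\le N}$ (one factor $T$ per vertex of $\mathcal B_a$, the $i$-th indices of two factors being contracted when they are joined by an edge of colour $i$). The $\mathrm O(N)^R$ tensor model with enhanced scaling has the action $$S(T)=\frac{N^{R-1}}{2}\,T\cdot T+\sum_{a\in\mathcal S}g_a\,\mathcal I_{\mathcal B_a}(T),\qquad g_a=N^{R-c(\mathcal B_a)+\frac{2}{(R-1)!}\deg\mathcal B_a}\,\lambda_a ,$$ and its free energy $F$ is the formal power series in the $\lambda_a$, vanishing at $\lambda=0$, such that $e^{-F}=Z$, where $Z=\int[dT]\,e^{-S(T)}$, normalized by $Z|_{\lambda=0}=1$, is expanded as a formal power series in the $\lambda_a$, its coefficients being Gaussian integrals. A Feynman graph $\mathcal G$ is made of finitely many interaction vertices $i$, of types $a_i\in\mathcal S$, whose fields (the vertices of the bubbles $\mathcal B_{a_i}$) are matched in pairs by propagators; it is connected if its interaction vertices are connected through the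 propagators (an interaction vertex counts as connected even when its bubble is not). Adding to the bubbles $\mathcal B_{a_i}$ an edge of colour $0$ for each propagator gives the $(R+1)$-bubble $\mathcal B$ of $\mathcal G$. The amplitude $\mathcal A(\mathcal G)$ is obtained from a factor $-g_{a_i}$ for each interaction vertex, a factor $N^{-(R-1)}$ for each propagator, and the sum over all the tensor indices, indices being identified along the strands of the interaction vertices and of the propagators. With $p$ the number of propagators, $v$ the number of interaction vertices and $f$ the number of closed stranded loops, let $$\ell(\mathcal G)=(R-1)\Bigl[R+(R-1)p-Rv+\sum_{i}c(\mathcal B_{a_i})-\frac{2}{(R-1)!}\sum_{i}\deg\mathcal B_{a_i}-f\Bigr].$$ Theorem. (1) For every connected Feynman graph $\mathcal G$ with $(R+1)$-bubble $\mathcal B$, $$\ell(\mathcal G)=2\,\mathrm{ind}_0\,\mathcal B+R(R-1)\Bigl[1+\sum_{i}\bigl(c(\mathcal B_{a_i})-1\bigr)-c(\mathcal B)\Bigr],$$ $\ell(\mathcal G)\ge 0$ and $\ell(\mathcal G)\in\mathbb N$. For every $N\ge 1$, $$\mathcal A(\mathcal G)=\Bigl(\prod_i(-\lambda_{a_i})\Bigr)N^{R-\frac{\ell(\mathcal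 G)}{R-1}},$$ so that the power of $N$ is bounded above by $R$. (2) Consequently the free energy has a well-defined expansion in powers of $1/N^{1/(R-1)}$: for every $N\ge 1$ it exists, is unique, and $$F=\sum_{\ell\in\mathbb N}N^{R-\frac{\ell}{R-1}}F_\ell$$ coefficient by coefficient in the $\lambda_a$, where the formal power series $F_\ell$ do not depend on $N$: the coefficient of $\prod_a\lambda_a^{n_a}$ in $F_\ell$ is $-\prod_a\frac{(-1)^{n_a}}{n_a!}$ times the number of connected Feynman graphs with parameter $\ell$ and with $n_a$ labelled interaction vertices of type $a$ for each $a$. For each monomial in the $\lambda_a$, only finitely many $\ell$ contribute. -/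

import Mathlib

namespace TensorModel

open MeasureTheory ProbabilityTheory

/-- The number of classes of the equivalence relation generated by `r`, i.e. the number of
connected components of the graph on `α` in which `x` and `y` are joined whenever `r x y`. -/
noncomputable def numClasses {α : Type*} (r : α → α → Prop) : ℕ := Nat.card (Quot r)

theorem numClasses_congr {α β : Type*} {r : α → α → Prop} {s : β → β → Prop} (e : α ≃ β)
    (h₁ : ∀ x y, r x y → s (e x) (e y) ∨ s (e y) (e x))
    (h₂ : ∀ x y, s x y → r (e.symm x) (e.symm y) ∨ r (e.symm y) (e.symm x)) :
    numClasses r = numClasses s := by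
  refine Nat.card_congr
    { toFun := Quot.lift (fun x => Quot.mk s (e x)) fun x y hxy => ?_
      invFun := Quot.lift (fun x => Quot.mk r (e.symm x)) fun x y hxy => ?_
      left_inv := ?_
      right_inv := ?_ }
  · rcases h₁ x y hxy with h | h
    · exact Quot.sound h
    · exact (Quot.sound h).symm
  · rcases h₂ x y hxy with h | h
    · exact Quot.sound h
    · exact (Quot.sound h).symm
  · rintro ⟨x⟩
    simp
  · rintro ⟨x⟩
    simp

/-! ### Embedded graphs, as signed rotation systems -/

/-- A graph embedded on a (not necessarily orientable) closed surface, given by a signed rotation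
system on its set `H` of half-edges: `rot` sends a half-edge to the next one around the same
vertex (the vertices are the cycles of `rot`), `flip` exchanges the two halves of every edge, and
`sign` is the signature of the edge (`1` for an untwisted ribbon, `-1` for a twisted one). -/
structure EmbeddedGraph (H : Type*) where
  rot : Equiv.Perm H
  flip : H → H
  flip_flip : ∀ h, flip (flip h) = h
  flip_ne : ∀ h, flip h ≠ h
  sign : H → ℤˣ
  sign_flip : ∀ h, sign (flip h) = sign h

namespace EmbeddedGraph

variable {H : Type*} (J : EmbeddedGraph H)

noncomputable def numVertices : ℕ := numClasses fun h h' => J.rot h = h'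

noncomputable def numEdges : ℕ := numClasses fun h h' => J.flip h = h'

noncomputable def numComponents : ℕ := numClasses fun h h' => J.rot h = h' ∨ J.flip h = h'

/-- Following the boundary of the ribbon graph. The pair `(h, 1)` is the side of the half-ribbon
`h` facing `rot h`, and `(h, -1)` is its other side. At the vertex, the side of `h` facing `rot h`
is joined to the side of `rot h` facing `h`. Along an edge, an untwisted ribbon joins
`(h, s)` to `(flip h, -s)` and a twisted one joins `(h, s)` to `(flip h, s)`. -/
def BoundaryStep (x y : H × ℤˣ) : Prop :=
  (x.2 = 1 ∧ y = (J.rot x.1, -1)) ∨ y = (J.flip x.1, -(J.sign x.1 * x.2))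

/-- The faces are the boundary components of the ribbon graph. -/
noncomputable def numFaces : ℕ := numClasses J.BoundaryStep

/-- The genus (half-integral in the non-orientable case), summed over the connected components,
by Euler's formula `2c - 2g = V - E + F`. -/
noncomputable def genus : ℝ :=
  J.numComponents - ((J.numVertices : ℝ) - J.numEdges + J.numFaces) / 2

end EmbeddedGraph

/-! ### Bubbles -/

/-- A bubble with set of colors `C` and vertex set `V`: a graph without loops (multiple edges are
allowed) whose edges are colored by `C`, such that each color is incident exactly once at each
vertex. It is determined by the neighbour `nbr c v` of the vertex `v` along its edge of
color `c`. A `d`-bubble is a bubble with `d` colors. -/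
structure Bubble (C V : Type*) where
  nbr : C → V → V
  nbr_nbr : ∀ c v, nbr c (nbr c v) = v
  nbr_ne : ∀ c v, nbr c v ≠ v

namespace Bubble

variable {C V : Type*}

/-- The number `c(B)` of connected components. -/
noncomputable def numComponents (B : Bubble C V) : ℕ := numClasses fun v w => ∃ c, B.nbr c v = w

/-- The `R`-bubble `B^{(0)}` obtained from the `(R+1)`-bubble `B` by deleting the edges of
color `0`; the color `i.succ` of `B` becomes the color `i`. -/
def deleteZero {R : ℕ} (B : Bubble (Fin (R + 1)) V) : Bubble (Fin R) V where
  nbr i := B.nbr i.succ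
  nbr_nbr i := B.nbr_nbr i.succ
  nbr_ne i := B.nbr_ne i.succ

/-- The jacket of `B` associated with the permutation `σ` of the colors (to be taken cyclic) and
the partition of the vertices into the unfilled ones (`o v = 1`) and the filled ones (`o v = -1`).
The edges are ordered according to `σ` around the unfilled vertices and according to `σ⁻¹` around
the filled ones; the signature of an edge is `-1` when it joins two vertices of the same type and
`1` otherwise. The half-edges are the pairs (vertex, color). -/
def jacket (B : Bubble C V) (σ : Equiv.Perm C) (o : V → ℤˣ) : EmbeddedGraph (V × C) where
  rot := Equiv.prodCongrRight fun v => σ ^ (o v : ℤ)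
  flip h := (B.nbr h.2 h.1, h.2)
  flip_flip h := by simp [B.nbr_nbr]
  flip_ne h hh := B.nbr_ne h.2 h.1 (congrArg Prod.fst hh)
  sign h := -(o h.1 * o (B.nbr h.2 h.1))
  sign_flip h := by simp [B.nbr_nbr, mul_comm]

/-- The genus of a jacket does not depend on the partition of the vertices. -/
theorem genus_jacket (B : Bubble C V) (σ : Equiv.Perm C) (o : V → ℤˣ) :
    (B.jacket σ o).genus = (B.jacket σ 1).genus := by
  have key : ∀ (v : V) (c c' : C), (σ ^ (o v : ℤ)) c = c' → σ c = c' ∨ σ c' = c := by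
    intro v c c' h
    rcases Int.units_eq_one_or (o v) with ho | ho
    · left; simpa [ho] using h
    · right; rw [← h]; simp [ho]
  have key' : ∀ (v : V) (c c' : C), σ c = c' →
      (σ ^ (o v : ℤ)) c = c' ∨ (σ ^ (o v : ℤ)) c' = c := by
    intro v c c' h
    rcases Int.units_eq_one_or (o v) with ho | ho
    · left; simpa [ho] using h
    · right; rw [← h]; simp [ho]
  have hV : (B.jacket σ o).numVertices = (B.jacket σ 1).numVertices := by
    refine numClasses_congr (Equiv.refl _) ?_ ?_
    · rintro ⟨v, c⟩ ⟨w, c'⟩ h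
      simp only [jacket, Equiv.prodCongrRight_apply, Prod.mk.injEq] at h
      obtain ⟨rfl, h⟩ := h
      simpa [jacket] using key _ _ _ h
    · rintro ⟨v, c⟩ ⟨w, c'⟩ h
      simp only [jacket, Equiv.prodCongrRight_apply, Prod.mk.injEq, Pi.one_apply, Units.val_one,
        zpow_one] at h
      obtain ⟨rfl, h⟩ := h
      simpa [jacket] using key' v _ _ h
  have hE : (B.jacket σ o).numEdges = (B.jacket σ 1).numEdges := rfl
  have hC : (B.jacket σ o).numComponents = (B.jacket σ 1).numComponents := by
    refine numClasses_congr (Equiv.refl _) ?_ ?_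
    · rintro ⟨v, c⟩ ⟨w, c'⟩ (h | h)
      · simp only [jacket, Equiv.prodCongrRight_apply, Prod.mk.injEq] at h
        obtain ⟨rfl, h⟩ := h
        rcases key _ _ _ h with h | h <;> simp [jacket, h]
      · left; right; exact h
    · rintro ⟨v, c⟩ ⟨w, c'⟩ (h | h)
      · simp only [jacket, Equiv.prodCongrRight_apply, Prod.mk.injEq, Pi.one_apply, Units.val_one,
          zpow_one] at h
        obtain ⟨rfl, h⟩ := h
        rcases key' v _ _ h with h | h <;> simp [jacket, h]
      · left; right; exact h
  have hsq : ∀ u : ℤˣ, u * u = 1 := Int.units_mul_self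
  have hF : (B.jacket σ o).numFaces = (B.jacket σ 1).numFaces := by
    let f : (V × C) × ℤˣ → (V × C) × ℤˣ := fun x => (x.1, o x.1.1 * x.2)
    have hf : Function.Involutive f := fun x => by simp [f, ← mul_assoc, hsq]
    refine numClasses_congr hf.toPerm ?_ ?_
    · rintro ⟨⟨v, c⟩, s⟩ ⟨⟨w, c'⟩, t⟩ h
      rcases h with ⟨hs, h⟩ | h
      · simp only [jacket, Equiv.prodCongrRight_apply, Prod.mk.injEq] at h hs
        obtain ⟨⟨rfl, rfl⟩, rfl⟩ := h
        subst hs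
        rcases Int.units_eq_one_or (o w) with ho | ho
        · left; left; simp [f, ho, jacket]
        · right; left; simp [f, ho, jacket]
      · simp only [jacket, Prod.mk.injEq] at h
        obtain ⟨⟨rfl, rfl⟩, rfl⟩ := h
        left; right
        simp only [Function.Involutive.coe_toPerm, f, jacket, Pi.one_apply, Prod.mk.injEq, true_and]
        simp only [neg_mul, neg_neg, mul_one, one_mul]
        rw [mul_comm (o v), mul_assoc, ← mul_assoc (o _) (o _), hsq, one_mul]
    · rintro ⟨⟨v, c⟩, s⟩ ⟨⟨w, c'⟩, t⟩ h
      rcases h with ⟨hs, h⟩ | h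
      · simp only [jacket, Equiv.prodCongrRight_apply, Prod.mk.injEq, Pi.one_apply, Units.val_one,
          zpow_one] at h hs
        obtain ⟨⟨rfl, rfl⟩, rfl⟩ := h
        subst hs
        rcases Int.units_eq_one_or (o w) with ho | ho
        · left; left; simp [f, ho, jacket]
        · right; left; simp [f, ho, jacket]
      · simp only [jacket, Prod.mk.injEq, Pi.one_apply] at h
        obtain ⟨⟨rfl, rfl⟩, rfl⟩ := h
        left; right
        simp only [Function.Involutive.toPerm_symm, Function.Involutive.coe_toPerm, f, jacket,
          Prod.mk.injEq, true_and]
        simp only [neg_mul, neg_neg, mul_one, one_mul]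
        rw [mul_comm (o v) (o _), mul_assoc, ← mul_assoc (o v), hsq, one_mul]
  simp only [EmbeddedGraph.genus, hV, hE, hC, hF]

open scoped Classical in
/-- The degree: half of the sum of the genera of the jackets over all the cyclic permutations of
the colors. The partition of the vertices used here is irrelevant by `genus_jacket`. -/
noncomputable def degree [Fintype C] [DecidableEq C] (B : Bubble C V) : ℝ :=
  (1 / 2) * ∑ σ : Equiv.Perm C with σ.IsCycle ∧ σ.support = Finset.univ, (B.jacket σ 1).genus

/-- The index `ind_0(B)` of a `d`-bubble with respect to the color `0`, where `d = R + 1`: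
`ind_0(B) = (deg B - (d - 1) deg B^{(0)}) / (d - 3)!`. -/
noncomputable def index {R : ℕ} (B : Bubble (Fin (R + 1)) V) : ℝ :=
  (B.degree - R * B.deleteZero.degree) / (R - 2).factorial

end Bubble

/-! ### Feynman graphs

A model is given by its interaction bubbles `B a`, `a : S`; the vertex set of `B a` is `W a`. -/

section Model

variable {R : ℕ} {S : Type*} {W : S → Type*} (B : ∀ a, Bubble (Fin R) (W a))

/-- A Feynman graph whose set of interaction vertices is `I`, the vertex `i` being of type `t i`.
Its fields are the pairs `⟨i, x⟩` with `x : W (t i)`; the propagators of the graph match these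
fields in pairs (a Wick contraction). -/
structure FeynmanGraph (_B : ∀ a, Bubble (Fin R) (W a)) {I : Type*} (t : I → S) where
  wick : (Σ i, W (t i)) → (Σ i, W (t i))
  wick_wick : ∀ x, wick (wick x) = x
  wick_ne : ∀ x, wick x ≠ x

/-- The `R`-bubble formed by all the interaction bubbles of a Feynman graph. -/
def interactionBubble {I : Type*} (t : I → S) : Bubble (Fin R) (Σ i, W (t i)) where
  nbr c x := ⟨x.1, (B (t x.1)).nbr c x.2⟩
  nbr_nbr c x := by simp [(B (t x.1)).nbr_nbr]
  nbr_ne c x h := (B (t x.1)).nbr_ne c x.2 (eq_of_heq (Sigma.mk.inj h).2)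

namespace FeynmanGraph

variable {B} {I : Type*} {t : I → S} (G : FeynmanGraph B t)

/-- The `(R+1)`-bubble of a Feynman graph in the colored representation: the edges of color `0`
are the propagators, the edges of the other colors are those of the interaction bubbles. -/
def bubble : Bubble (Fin (R + 1)) (Σ i, W (t i)) where
  nbr c := Fin.cases (motive := fun _ => (Σ i, W (t i)) → (Σ i, W (t i)))
    G.wick (interactionBubble B t).nbr c
  nbr_nbr c := by
    refine Fin.cases ?_ (fun i => ?_) c
    · exact G.wick_wick
    · exact (interactionBubble B t).nbr_nbr i
  nbr_ne c := by
    refine Fin.cases ?_ (fun i => ?_) c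
    · exact G.wick_ne
    · exact (interactionBubble B t).nbr_ne i

/-- A Feynman graph is connected if its interaction vertices are connected by the propagators (an
interaction vertex counts as connected even when its interaction bubble is not). -/
def IsConnected : Prop := numClasses (fun i j : I => ∃ x, x.1 = i ∧ (G.wick x).1 = j) = 1

/-- The number `p` of propagators. -/
noncomputable def numPropagators : ℕ := numClasses fun x y => G.wick x = y

/-- The number `f` of closed stranded loops. The field `x` carries a strand of each color `c`.
Strands of the same color are joined by the corners of the interaction vertices and by the
propagators. -/
noncomputable def numStrandedLoops : ℕ :=
  numClasses fun x y : Fin R × (Σ i, W (t i)) =>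
    y = (x.1, (interactionBubble B t).nbr x.1 x.2) ∨ y = (x.1, G.wick x.2)

/-- The parameter `ℓ`, such that the amplitude scales as `N ^ (R - ℓ / (R - 1))` in the enhanced
scaling. -/
noncomputable def ell [Fintype I] : ℝ :=
  ((R : ℝ) - 1) * (R + ((R : ℝ) - 1) * G.numPropagators - R * Fintype.card I
    + ∑ i, ((B (t i)).numComponents : ℝ)
    - 2 / (R - 1).factorial * ∑ i, (B (t i)).degree - G.numStrandedLoops)

end FeynmanGraph

/-- The enhanced scaling `g_a = N ^ (R - c(B_a) + 2 deg(B_a) / (R-1)!) * λ_a` of the coupling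
constants. -/
noncomputable def enhancedCoupling (N : ℕ) (lam : S → ℝ) (a : S) : ℝ :=
  (N : ℝ) ^ ((R : ℝ) - (B a).numComponents + 2 / (R - 1).factorial * (B a).degree) * lam a

open scoped Classical in
/-- The amplitude of a Feynman graph: a factor `-g_a` for each interaction vertex, a factor
`1 / N ^ (R - 1)` for each propagator, and a sum over the indices `j x c` of all the fields `x`,
where the indices of color `c` of two fields are identified when they are contracted together in
an interaction vertex, and all the indices of two fields joined by a propagator are identified. -/
noncomputable def FeynmanGraph.amplitude {B : ∀ a, Bubble (Fin R) (W a)} [∀ a, Fintype (W a)]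
    {I : Type*} [Fintype I] {t : I → S} (G : FeynmanGraph B t) (N : ℕ) (lam : S → ℝ) : ℝ :=
  (∏ i, -enhancedCoupling B N lam (t i)) * (1 / (N : ℝ) ^ (R - 1)) ^ G.numPropagators *
    ∑ j : (Σ i, W (t i)) → Fin R → Fin N,
      if (∀ c x, j ((interactionBubble B t).nbr c x) c = j x c) ∧ (∀ x, j (G.wick x) = j x)
        then 1 else 0

/-! ### The free energy -/

open scoped Classical in
/-- The trace invariant `I_b(T)` of a real tensor `T` of rank `R`: one entry of `T` for each vertex
of the bubble `b`, with the indices of color `c` of two entries contracted if they are joined by an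
edge of color `c`. -/
noncomputable def traceInvariant {V : Type*} [Fintype V] (b : Bubble (Fin R) V) {N : ℕ}
    (T : (Fin R → Fin N) → ℝ) : ℝ :=
  ∑ j : V → Fin R → Fin N, if ∀ c v, j (b.nbr c v) c = j v c then ∏ v, T (j v) else 0

/-- The normalized Gaussian measure with density proportional to `exp (-(N ^ (R-1) / 2) T·T)`. -/
noncomputable def gaussianTensor (R N : ℕ) : Measure ((Fin R → Fin N) → ℝ) :=
  Measure.pi fun _ => gaussianReal 0 (1 / (N : NNReal) ^ (R - 1))

/-- The perturbative partition function with enhanced scaling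
`Z = ∫ exp (-∑ a, g_a I_a(T)) dμ(T)`, with `μ` Gaussian, as a formal power series in the
parameters `λ_a`: the coefficient of `∏ a, λ_a ^ n_a` is
`∫ ∏ a, (-(g_a / λ_a) I_a(T)) ^ n_a / n_a! dμ(T)`. -/
noncomputable def partitionFunction [∀ a, Fintype (W a)] (N : ℕ) : MvPowerSeries S ℝ :=
  fun n => ∫ T, n.prod (fun a k =>
    (-(enhancedCoupling B N 1 a * traceInvariant (B a) T)) ^ k / k.factorial) ∂gaussianTensor R N

/-- `F` is the perturbative free energy: `exp (-F) = Z` as formal power series in the `λ_a`, with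
`F` vanishing at `λ = 0`. -/
def IsFreeEnergy [∀ a, Fintype (W a)] (N : ℕ) (F : MvPowerSeries S ℝ) : Prop :=
  MvPowerSeries.constantCoeff F = 0 ∧
    PowerSeries.subst (-F) (PowerSeries.exp ℝ) = partitionFunction B N

/-- The coefficient `F_ℓ` of the large `N` expansion, a formal power series in the `λ_a` which does
not involve `N`. The connected Feynman graphs with parameter `ℓ` and with `n_a` interaction vertices
of type `a`, labelled by `Fin (n_a)`, contribute to the coefficient of `∏ a, λ_a ^ n_a` with the
weight `-∏ a, (-1) ^ n_a / n_a!` each. -/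
noncomputable def freeEnergyCoeff (l : ℕ) : MvPowerSeries S ℝ := fun n =>
  -(n.prod fun _ k => (-1 : ℝ) ^ k / k.factorial) *
    Nat.card {G : FeynmanGraph B (fun i : (Σ a : n.support, Fin (n a)) => i.1.1) //
      G.IsConnected ∧ G.ell = l}

end Model

end TensorModel

open TensorModel

/-!
The degree of a bubble is computed by counting. The faces of the jacket of a cyclic permutation `σ`
of the `d` colours are the cycles with two consecutive colours `c`, `σ c`, and `(d - 2)!` of the
`(d - 1)!` cyclic permutations send `c` to a given `c' ≠ c`. Hence the degree is a combination of
the numbers of components, of vertices and of two-coloured cycles (`Bubble.two_mul_degree`), and the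
formula for `ℓ` is a comparison of such combinations (`FeynmanGraph.ell_eq`).

The index is non-negative because twice the index is the sum over the pairs `i ≠ j` of non-zero
colours, each ordered pair with weight one half, of twice the genus of the three-coloured graph with
colours `0, i, j` plus twice the difference between the numbers of components which the edges of
colour `0` merge in the graph with colours `i, j` and in the graph with all the non-zero colours
(`Bubble.index_nonneg`). Both contributions are handled by linear algebra over `ZMod 2`: the number
of components of a graph is the dimension of the space of functions constant on the components
(`finrank_invariants`), so that the second contribution is the submodularity of the rank
(`numClasses_submodular`). For the first one, let `A`, `B`, `C` be the spaces of functions invariant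
under three involutions without fixed points. The modular law bounds the sum of the dimensions of
the pairwise intersections, and in characteristic two the orthogonal of `A + B + C` consists of
functions in `A ∩ B ∩ C` (`numClasses_three_involutions`). Connectedness of a Feynman graph bounds
the number of its components by the same kind of dimension count
(`FeynmanGraph.numComponents_bubble_le`).

The sum over the tensor indices in an amplitude gives a factor `N` for each stranded loop, which
turns the definition of `ℓ` into the scaling of the amplitude (`FeynmanGraph.amplitude_eq_rpow`).
Wick's theorem (`integral_prod_gaussian`) follows from the recursion for the moments of a Gaussian,
obtained by integration by parts, and expresses the coefficients of the partition function as sums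
over Feynman graphs (`integral_prod_traceInvariant`).

The logarithm is taken by means of the operator which multiplies the coefficients of degree `k` of a
power series by `k`. It is a derivation, so that `Z = exp G` is equivalent to a recursion for
the coefficients (`subst_exp_eq_iff`), which determines `Z` from `G` and `G` from `Z`. The
combinatorial counterpart of the recursion is to mark an interaction vertex of a Feynman graph and
to split off its connected component (`card_mul_graphSum`). Therefore minus the free energy is the
exponential generating series of the connected graphs (`subst_connectedSeries`), and the expansion
in `N` is obtained by sorting these graphs according to `ℓ`.
-/

namespace TensorModel

open Module

/-! ### Counting classes -/

theorem numClasses_eq_card_of_equiv {α β : Type*} {r : α → α → Prop} (e : Quot r ≃ β) :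
    numClasses r = Nat.card β := Nat.card_congr e

/-- Two relations have equally many classes as soon as maps in both directions respect them and
are mutually inverse up to the relations. -/
theorem numClasses_eq_of_maps {α β : Type*} {r : α → α → Prop} {s : β → β → Prop}
    (f : α → β) (g : β → α)
    (hf : ∀ x y, r x y → Quot.mk s (f x) = Quot.mk s (f y))
    (hg : ∀ x y, s x y → Quot.mk r (g x) = Quot.mk r (g y))
    (hgf : ∀ x, Quot.mk r (g (f x)) = Quot.mk r x)
    (hfg : ∀ y, Quot.mk s (f (g y)) = Quot.mk s y) : numClasses r = numClasses s :=
  Nat.card_congr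
    { toFun := Quot.lift (fun x => Quot.mk s (f x)) hf
      invFun := Quot.lift (fun y => Quot.mk r (g y)) hg
      left_inv := by rintro ⟨x⟩; exact hgf x
      right_inv := by rintro ⟨y⟩; exact hfg y }

theorem numClasses_sigma {ι : Type*} [Fintype ι] {α : ι → Type*} [∀ i, Finite (α i)]
    {r : (Σ i, α i) → (Σ i, α i) → Prop} (s : ∀ i, α i → α i → Prop)
    (hr : ∀ x y, r x y → x.1 = y.1) (hs : ∀ i x y, r ⟨i, x⟩ ⟨i, y⟩ ↔ s i x y) :
    numClasses r = ∑ i, numClasses (s i) := by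
  unfold numClasses
  rw [← Nat.card_sigma]
  refine Nat.card_congr
    { toFun := Quot.lift (fun x => ⟨x.1, Quot.mk _ x.2⟩) ?_
      invFun := fun z => Quot.lift (fun x => Quot.mk r ⟨z.1, x⟩)
        (fun x y h => Quot.sound ((hs _ _ _).2 h)) z.2
      left_inv := by rintro ⟨x⟩; rfl
      right_inv := by rintro ⟨i, ⟨x⟩⟩; rfl }
  rintro ⟨i, x⟩ ⟨j, y⟩ h
  obtain rfl : i = j := hr _ _ h
  have : Quot.mk (s i) x = Quot.mk (s i) y := Quot.sound ((hs _ _ _).1 h)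
  simp [this]

theorem numClasses_sum {α β γ : Type*} [Finite α] [Finite β] (e : α ⊕ β ≃ γ)
    {r : γ → γ → Prop} (s : α → α → Prop) (t : β → β → Prop)
    (hs : ∀ x y, r (e (.inl x)) (e (.inl y)) ↔ s x y)
    (ht : ∀ x y, r (e (.inr x)) (e (.inr y)) ↔ t x y)
    (hst : ∀ x y, ¬ r (e (.inl x)) (e (.inr y))) (hts : ∀ x y, ¬ r (e (.inr x)) (e (.inl y))) :
    numClasses r = numClasses s + numClasses t := by
  unfold numClasses
  rw [← Nat.card_sum]
  symm
  refine Nat.card_congr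
    { toFun := Sum.elim
        (Quot.lift (fun x => Quot.mk r (e (.inl x))) fun x y h => Quot.sound ((hs _ _).2 h))
        (Quot.lift (fun x => Quot.mk r (e (.inr x))) fun x y h => Quot.sound ((ht _ _).2 h))
      invFun := Quot.lift (fun z => (e.symm z).map (Quot.mk s) (Quot.mk t)) ?_
      left_inv := by
        rintro (x | x) <;> obtain ⟨x, rfl⟩ := Quot.exists_rep x
        · change (e.symm (e (.inl x))).map (Quot.mk s) (Quot.mk t) = _
          simp
        · change (e.symm (e (.inr x))).map (Quot.mk s) (Quot.mk t) = _
          simp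
      right_inv := by
        rintro ⟨z⟩
        obtain ⟨x | x, rfl⟩ := e.surjective z <;> simp }
  intro z w h
  obtain ⟨x | x, rfl⟩ := e.surjective z <;> obtain ⟨y | y, rfl⟩ := e.surjective w
  · simpa using Quot.sound ((hs _ _).1 h)
  · exact absurd h (hst _ _)
  · exact absurd h (hts _ _)
  · simpa using Quot.sound ((ht _ _).1 h)

/-- The edges of a perfect matching. -/
theorem numClasses_involution {α : Type*} [Finite α] (f : α → α) (hf : ∀ x, f (f x) = x)
    (hne : ∀ x, f x ≠ x) : 2 * numClasses (fun x y => f x = y) = Nat.card α := by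
  classical
  have := Fintype.ofFinite α
  have hmk : ∀ x y, Quot.mk (fun x y => f x = y) x = Quot.mk _ y ↔ (y = x ∨ y = f x) := by
    intro x y
    constructor
    · intro h
      have h' := Quot.eqvGen_exact h
      clear h
      induction h' with
      | rel x y h => exact Or.inr h.symm
      | refl x => exact Or.inl rfl
      | symm x y _ ih => rcases ih with rfl | rfl <;> simp [hf]
      | trans x y z _ _ h1 h2 => rcases h1 with rfl | rfl <;> rcases h2 with rfl | rfl <;> simp [hf]
    · rintro (rfl | rfl)
      · rfl
      · exact Quot.sound rfl
  have hfin : Finite (Quot fun x y => f x = y) := inferInstance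
  have := Fintype.ofFinite (Quot fun x y => f x = y)
  rw [numClasses, Nat.card_eq_fintype_card, Nat.card_eq_fintype_card, ← Finset.card_univ (α := α),
    Finset.card_eq_sum_card_fiberwise (f := Quot.mk fun x y => f x = y) (t := Finset.univ)
      (fun _ _ => Finset.mem_coe.2 (Finset.mem_univ _))]
  rw [Finset.sum_const_nat (m := 2), Finset.card_univ, mul_comm]
  rintro ⟨x⟩ -
  rw [Finset.card_eq_two]
  refine ⟨x, f x, (hne x).symm, ?_⟩
  ext y
  simp only [Finset.mem_filter, Finset.mem_univ, true_and, Finset.mem_insert, Finset.mem_singleton]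
  rw [eq_comm, hmk]

/-! ### Functions constant on the classes -/

/-- The `ZMod 2`-valued functions which are constant on the classes of `r`. -/
def invariants {α : Type*} (r : α → α → Prop) : Submodule (ZMod 2) (α → ZMod 2) where
  carrier := {f | ∀ x y, r x y → f x = f y}
  add_mem' hf hg x y h := by simp [hf x y h, hg x y h]
  zero_mem' _ _ _ := rfl
  smul_mem' c f hf x y h := by simp [hf x y h]

theorem mem_invariants {α : Type*} {r : α → α → Prop} {f : α → ZMod 2} :
    f ∈ invariants r ↔ ∀ x y, r x y → f x = f y := Iff.rfl

theorem finrank_invariants {α : Type*} [Finite α] (r : α → α → Prop) :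
    finrank (ZMod 2) (invariants r) = numClasses r := by
  have := Fintype.ofFinite (Quot r)
  let e : invariants r ≃ₗ[ZMod 2] (Quot r → ZMod 2) :=
    { toFun := fun f => Quot.lift f.1 f.2
      map_add' := fun f g => by ext ⟨x⟩; rfl
      map_smul' := fun c f => by ext ⟨x⟩; rfl
      invFun := fun g => ⟨fun x => g (Quot.mk r x), fun x y h => congrArg g (Quot.sound h)⟩
      left_inv := fun f => rfl
      right_inv := fun g => by ext ⟨x⟩; rfl }
  rw [e.finrank_eq, finrank_fintype_fun_eq_card, numClasses, Nat.card_eq_fintype_card]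

theorem invariants_or {α : Type*} (r s : α → α → Prop) :
    invariants (fun x y => r x y ∨ s x y) = invariants r ⊓ invariants s := by
  ext f
  simp only [Submodule.mem_inf, mem_invariants]
  exact ⟨fun h => ⟨fun x y hxy => h x y (.inl hxy), fun x y hxy => h x y (.inr hxy)⟩,
    fun h x y hxy => hxy.elim (h.1 x y) (h.2 x y)⟩

theorem numClasses_or {α : Type*} [Finite α] (r s : α → α → Prop) :
    numClasses (fun x y => r x y ∨ s x y) = finrank (ZMod 2) ↥(invariants r ⊓ invariants s) := by
  rw [← finrank_invariants, invariants_or]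

theorem invariants_anti {α : Type*} {r s : α → α → Prop} (h : ∀ x y, r x y → s x y) :
    invariants s ≤ invariants r := fun _ hf x y hxy => hf x y (h x y hxy)

theorem numClasses_iff {α : Type*} {r s : α → α → Prop} (h : ∀ x y, r x y ↔ s x y) :
    numClasses r = numClasses s := by
  have : r = s := by ext x y; exact h x y
  rw [this]

/-- Adding the edges of `r` merges at most as many components of the finer graph `p` as of the
coarser graph `q`: the rank function of a graph is submodular. -/
theorem numClasses_submodular {α : Type*} [Finite α] (r p q : α → α → Prop)
    (h : ∀ x y, p x y → q x y) :
    numClasses q + numClasses (fun x y => r x y ∨ p x y) ≤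
      numClasses p + numClasses (fun x y => r x y ∨ q x y) := by
  rw [numClasses_or, numClasses_or, ← finrank_invariants, ← finrank_invariants]
  have h1 := Submodule.finrank_sup_add_finrank_inf_eq (invariants r) (invariants p)
  have h2 := Submodule.finrank_sup_add_finrank_inf_eq (invariants r) (invariants q)
  have h3 := Submodule.finrank_mono (sup_le_sup_left (invariants_anti h) (invariants r))
  omega

/-- For subspaces `A`, `B`, `C` the pairwise intersections satisfy this dimension inequality,
since `A ⊓ B ⊔ A ⊓ C ≤ A ⊓ (B ⊔ C)`. -/
theorem finrank_inf_add_le {K E : Type*} [Field K] [AddCommGroup E] [Module K E]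
    [FiniteDimensional K E] (A B C : Submodule K E) :
    finrank K ↥(A ⊓ B) + finrank K ↥(A ⊓ C) + finrank K ↥(B ⊓ C) + finrank K ↥(A ⊔ (B ⊔ C)) ≤
      finrank K A + finrank K B + finrank K C + finrank K ↥(A ⊓ B ⊓ C) := by
  have h1 := Submodule.finrank_sup_add_finrank_inf_eq (A ⊓ B) (A ⊓ C)
  have h2 := Submodule.finrank_sup_add_finrank_inf_eq A (B ⊔ C)
  have h3 := Submodule.finrank_sup_add_finrank_inf_eq B C
  have h4 : A ⊓ B ⊓ (A ⊓ C) = A ⊓ B ⊓ C := by rw [← inf_inf_distrib_left, inf_assoc]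
  have h5 := Submodule.finrank_mono (le_inf_sup (a := A) (b := B) (c := C))
  rw [h4] at h1
  omega

/-- Over `ZMod 2` the orthogonal of the functions invariant under an involution consists of
invariant functions. -/
theorem card_le_finrank_sup_add_finrank_inf {α : Type*} [Finite α] {a b c : α → α}
    (ha : ∀ x, a (a x) = x) (hb : ∀ x, b (b x) = x) (hc : ∀ x, c (c x) = x)
    (ha' : ∀ x, a x ≠ x) (hb' : ∀ x, b x ≠ x) (hc' : ∀ x, c x ≠ x) :
    Nat.card α ≤ finrank (ZMod 2) ↥(invariants (fun x y => a x = y) ⊔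
        (invariants (fun x y => b x = y) ⊔ invariants fun x y => c x = y)) +
      finrank (ZMod 2) ↥(invariants (fun x y => a x = y) ⊓ invariants (fun x y => b x = y) ⊓
        invariants fun x y => c x = y) := by
  classical
  have := Fintype.ofFinite α
  set P := invariants (fun x y => a x = y) ⊔
        (invariants (fun x y => b x = y) ⊔ invariants fun x y => c x = y) with hP
  set Q := invariants (fun x y => a x = y) ⊓ invariants (fun x y => b x = y) ⊓
        invariants fun x y => c x = y with hQ
  have h1 := Subspace.finrank_add_finrank_dualAnnihilator_eq P
  rw [finrank_fintype_fun_eq_card, ← Nat.card_eq_fintype_card] at h1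
  have key : ∀ f : α → α, (∀ x, f (f x) = x) → (∀ x, f x ≠ x) →
      invariants (fun x y => f x = y) ≤ P → ∀ φ ∈ P.dualAnnihilator, ∀ x y, f x = y →
        φ (Pi.single x 1) = φ (Pi.single y 1) := by
    rintro f hf hne hle φ hφ x _ rfl
    have hmem : (Pi.single x 1 + Pi.single (f x) 1 : α → ZMod 2) ∈
        invariants (fun x y => f x = y) := by
      rintro y _ rfl
      have e1 : f y = x ↔ y = f x := ⟨fun h => by rw [← h, hf], fun h => by rw [h, hf]⟩
      have e2 : f y = f x ↔ y = x := ⟨fun h => by rw [← hf y, h, hf], fun h => by rw [h]⟩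
      simp only [Pi.add_apply, Pi.single_apply, e1, e2]
      exact add_comm _ _
    have h0 := (Submodule.mem_dualAnnihilator φ).1 hφ _ (hle hmem)
    rw [map_add] at h0
    exact CharTwo.add_eq_zero.1 h0
  let g : P.dualAnnihilator →ₗ[ZMod 2] Q :=
    { toFun := fun φ => ⟨fun x => φ.1 (Pi.single x 1),
        ⟨⟨key a ha ha' le_sup_left φ.1 φ.2,
          key b hb hb' (le_sup_left.trans le_sup_right) φ.1 φ.2⟩,
          key c hc hc' (le_sup_right.trans le_sup_right) φ.1 φ.2⟩⟩
      map_add' := fun φ ψ => rfl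
      map_smul' := fun k φ => rfl }
  have hg : Function.Injective g := by
    intro φ ψ h
    have h' := congrArg Subtype.val h
    ext x
    exact congrFun h' x
  have h2 := LinearMap.finrank_le_finrank_of_injective hg
  omega

/-- Euler's inequality `V - E + F ≤ 2c` for a graph whose edges are properly coloured with three
colours, whose faces are the two-coloured cycles. -/
theorem numClasses_three_involutions {α : Type*} [Finite α] {a b c : α → α}
    (ha : ∀ x, a (a x) = x) (hb : ∀ x, b (b x) = x) (hc : ∀ x, c (c x) = x)
    (ha' : ∀ x, a x ≠ x) (hb' : ∀ x, b x ≠ x) (hc' : ∀ x, c x ≠ x) :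
    2 * (numClasses (fun x y => a x = y ∨ b x = y) + numClasses (fun x y => a x = y ∨ c x = y) +
      numClasses (fun x y => b x = y ∨ c x = y)) ≤
    Nat.card α + 4 * numClasses (fun x y => (a x = y ∨ b x = y) ∨ c x = y) := by
  have h1 := card_le_finrank_sup_add_finrank_inf ha hb hc ha' hb' hc'
  have h3 := numClasses_involution a ha ha'
  have h4 := numClasses_involution b hb hb'
  have h5 := numClasses_involution c hc hc'
  rw [← finrank_invariants] at h3 h4 h5
  have e1 := numClasses_or (fun x y => a x = y) (fun x y => b x = y)
  have e2 := numClasses_or (fun x y => a x = y) (fun x y => c x = y)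
  have e3 := numClasses_or (fun x y => b x = y) (fun x y => c x = y)
  have e4 := numClasses_or (fun x y => a x = y ∨ b x = y) (fun x y => c x = y)
  rw [invariants_or (fun x y => a x = y) (fun x y => b x = y)] at e4
  rw [e1, e2, e3, e4]
  have h2 := finrank_inf_add_le (invariants fun x y => a x = y) (invariants fun x y => b x = y)
    (invariants fun x y => c x = y)
  omega

theorem numClasses_prod {ι α : Type*} [Fintype ι] [Finite α]
    {r : ι × α → ι × α → Prop} (s : ι → α → α → Prop)
    (hr : ∀ x y, r x y → x.1 = y.1) (hs : ∀ i x y, r (i, x) (i, y) ↔ s i x y) :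
    numClasses r = ∑ i, numClasses (s i) := by
  rw [← numClasses_sigma (r := fun x y : Σ _ : ι, α => r (x.1, x.2) (y.1, y.2)) s
    (fun x y h => hr _ _ h) hs]
  exact numClasses_congr (Equiv.sigmaEquivProd ι α).symm (fun x y h => .inl h) (fun x y h => .inl h)

/-! ### Degrees in terms of two-coloured cycles -/

open scoped Classical in
/-- The permutations consisting of one cycle through all the points. -/
noncomputable def fullCycles (C : Type*) [Fintype C] [DecidableEq C] : Finset (Equiv.Perm C) :=
  {σ | σ.IsCycle ∧ σ.support = Finset.univ}

theorem mem_fullCycles {C : Type*} [Fintype C] [DecidableEq C] {σ : Equiv.Perm C} :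
    σ ∈ fullCycles C ↔ σ.IsCycle ∧ σ.support = Finset.univ := by
  simp [fullCycles]

theorem card_fullCycles {C : Type*} [Fintype C] [DecidableEq C] (hC : 2 ≤ Fintype.card C) :
    (fullCycles C).card = (Fintype.card C - 1).factorial := by
  have h := Equiv.Perm.card_of_cycleType_singleton (α := C) hC le_rfl
  rw [Nat.choose_self, mul_one] at h
  rw [← h]
  congr 1
  ext σ
  rw [mem_fullCycles, Finset.mem_filter]
  constructor
  · rintro ⟨h1, h2⟩
    exact ⟨Finset.mem_univ _, by rw [h1.cycleType, h2, Finset.card_univ]⟩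
  · rintro ⟨-, h1⟩
    have h2 : σ.IsCycle := by rw [← Equiv.Perm.card_cycleType_eq_one, h1, Multiset.card_singleton]
    refine ⟨h2, ?_⟩
    rw [h2.cycleType, Multiset.singleton_inj] at h1
    exact Finset.eq_univ_of_card _ h1

theorem conj_mem_fullCycles {C : Type*} [Fintype C] [DecidableEq C] {σ : Equiv.Perm C}
    (hσ : σ ∈ fullCycles C) (τ : Equiv.Perm C) : τ * σ * τ⁻¹ ∈ fullCycles C := by
  rw [mem_fullCycles] at *
  refine ⟨hσ.1.conj, ?_⟩
  rw [Equiv.Perm.support_conj, hσ.2, Finset.map_univ_equiv]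

/-- By symmetry, a full cycle maps `c` to each of the other points equally often. -/
theorem card_fullCycles_apply_eq {C : Type*} [Fintype C] [DecidableEq C]
    (hC : 2 ≤ Fintype.card C) (c c' : C) :
    ((fullCycles C).filter fun σ => σ c = c').card =
      if c = c' then 0 else (Fintype.card C - 2).factorial := by
  split_ifs with hcc
  · subst hcc
    rw [Finset.card_eq_zero, Finset.filter_eq_empty_iff]
    intro σ hσ h
    have : c ∈ σ.support := by rw [(mem_fullCycles.1 hσ).2]; exact Finset.mem_univ _
    exact Equiv.Perm.mem_support.1 this h
  have hsymm : ∀ d, d ≠ c → ((fullCycles C).filter fun σ => σ c = d).card =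
      ((fullCycles C).filter fun σ => σ c = c').card := by
    intro d hd
    refine Finset.card_bij' (fun σ _ => Equiv.swap d c' * σ * (Equiv.swap d c')⁻¹)
      (fun σ _ => (Equiv.swap d c')⁻¹ * σ * Equiv.swap d c') ?_ ?_ ?_ ?_
    · intro σ hσ
      rw [Finset.mem_filter] at hσ ⊢
      refine ⟨conj_mem_fullCycles hσ.1 _, ?_⟩
      simp [Equiv.swap_apply_of_ne_of_ne (Ne.symm hd) hcc, hσ.2]
    · intro σ hσ
      rw [Finset.mem_filter] at hσ ⊢
      refine ⟨by simpa using conj_mem_fullCycles hσ.1 (Equiv.swap d c')⁻¹, ?_⟩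
      simp [Equiv.swap_apply_of_ne_of_ne (Ne.symm hd) hcc, hσ.2]
    · intro σ _; group
    · intro σ _; group
  have htot : (fullCycles C).card =
      ∑ d ∈ Finset.univ.erase c, ((fullCycles C).filter fun σ => σ c = d).card := by
    refine Finset.card_eq_sum_card_fiberwise fun σ hσ => ?_
    have : c ∈ σ.support := by
      rw [(mem_fullCycles.1 (Finset.mem_coe.1 hσ)).2]; exact Finset.mem_univ _
    simpa using Equiv.Perm.mem_support.1 this
  rw [Finset.sum_congr rfl fun d hd => hsymm d (Finset.ne_of_mem_erase hd), Finset.sum_const,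
    Finset.card_erase_of_mem (Finset.mem_univ _), Finset.card_univ, card_fullCycles hC,
    smul_eq_mul] at htot
  obtain ⟨k, hk⟩ := Nat.exists_eq_add_of_le hC
  rw [hk] at htot ⊢
  have e1 : 2 + k - 1 = k + 1 := by omega
  have e2 : 2 + k - 2 = k := by omega
  rw [e1, Nat.factorial_succ] at htot
  rw [e2]
  exact (Nat.eq_of_mul_eq_mul_left (Nat.succ_pos k) htot).symm

namespace Bubble

variable {C V : Type*}

/-- The number of cycles of a bubble whose edges have the colours `c` and `c'`. -/
noncomputable def numFaces (B : Bubble C V) (c c' : C) : ℕ :=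
  numClasses fun v w => B.nbr c v = w ∨ B.nbr c' v = w

theorem numFaces_comm (B : Bubble C V) (c c' : C) : B.numFaces c c' = B.numFaces c' c :=
  numClasses_iff fun _ _ => or_comm

/-- Points indexed by the colours lie in one class if each is related to the next one along a full
cycle. -/
theorem quot_mk_eq_of_fullCycle {α : Type*} {r : α → α → Prop} [Fintype C] [DecidableEq C]
    {σ : Equiv.Perm C} (hσ : σ ∈ fullCycles C) (f : C → α) (h : ∀ c, r (f c) (f (σ c))) (c d : C) :
    Quot.mk r (f c) = Quot.mk r (f d) := by
  rw [mem_fullCycles] at hσ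
  have hne : ∀ c, σ c ≠ c := fun c => by
    have : c ∈ σ.support := by rw [hσ.2]; exact Finset.mem_univ _
    exact Equiv.Perm.mem_support.1 this
  obtain ⟨n, rfl⟩ := hσ.1.exists_pow_eq (hne c) (hne d)
  clear hσ hne
  induction n with
  | zero => rfl
  | succ n ih => rw [ih, pow_succ', Equiv.Perm.mul_apply]; exact Quot.sound (h _)

theorem numVertices_jacket [Fintype C] [DecidableEq C] [Nonempty C] (B : Bubble C V)
    {σ : Equiv.Perm C} (hσ : σ ∈ fullCycles C) :
    (B.jacket σ 1).numVertices = Nat.card V := by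
  obtain ⟨c₀⟩ := ‹Nonempty C›
  refine numClasses_eq_card_of_equiv
    { toFun := Quot.lift Prod.fst ?_
      invFun := fun v => Quot.mk _ (v, c₀)
      left_inv := ?_
      right_inv := fun v => rfl }
  · rintro ⟨v, c⟩ _ rfl
    rfl
  · rintro ⟨v, c⟩
    exact quot_mk_eq_of_fullCycle hσ (fun c => (v, c)) (fun c => by simp [jacket]) _ _

theorem numEdges_jacket [Fintype C] [Finite V] (B : Bubble C V) (σ : Equiv.Perm C) :
    2 * (B.jacket σ 1).numEdges = Nat.card V * Fintype.card C := by
  rw [← Nat.card_eq_fintype_card, ← Nat.card_prod]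
  exact numClasses_involution _ (B.jacket σ 1).flip_flip (B.jacket σ 1).flip_ne

theorem numComponents_jacket [Fintype C] [DecidableEq C] [Nonempty C] (B : Bubble C V)
    {σ : Equiv.Perm C} (hσ : σ ∈ fullCycles C) :
    (B.jacket σ 1).numComponents = B.numComponents := by
  obtain ⟨c₀⟩ := ‹Nonempty C›
  have hmk : ∀ v c d, Quot.mk (fun h h' => (B.jacket σ 1).rot h = h' ∨ (B.jacket σ 1).flip h = h')
      (v, c) = Quot.mk _ (v, d) := fun v c d =>
    quot_mk_eq_of_fullCycle hσ (fun c => (v, c)) (fun c => by simp [jacket]) c d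
  refine numClasses_eq_of_maps Prod.fst (fun v => (v, c₀)) ?_ ?_ ?_ ?_
  · rintro ⟨v, c⟩ _ (rfl | rfl)
    · rfl
    · exact Quot.sound ⟨c, rfl⟩
  · rintro v _ ⟨c, rfl⟩
    rw [hmk v c₀ c, hmk (B.nbr c v) c₀ c]
    exact Quot.sound (Or.inr rfl)
  · rintro ⟨v, c⟩
    exact hmk v c₀ c
  · intro v
    rfl

/-- The faces of a jacket are the cycles with two consecutive colours. -/
theorem numFaces_jacket [Fintype C] [Finite V] (B : Bubble C V) (σ : Equiv.Perm C) :
    (B.jacket σ 1).numFaces = ∑ c, B.numFaces c (σ c) := by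
  let r : C × V → C × V → Prop := fun x y =>
    x.1 = y.1 ∧ (B.nbr x.1 x.2 = y.2 ∨ B.nbr (σ x.1) x.2 = y.2)
  have h1 : numClasses r = ∑ c, B.numFaces c (σ c) :=
    numClasses_prod _ (fun x y h => h.1) (fun c v w => by simp [r])
  rw [← h1]
  -- The corner between the colours `c` and `σ c` at `v` has the two sides `((v, c), 1)` and
  -- `((v, σ c), -1)`.
  refine numClasses_eq_of_maps
    (fun x => (if x.2 = 1 then x.1.2 else σ.symm x.1.2, x.1.1)) (fun x => ((x.2, x.1), 1))
    ?_ ?_ ?_ ?_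
  · rintro ⟨⟨v, c⟩, s⟩ y (⟨hs, rfl⟩ | rfl)
    · dsimp only at hs
      subst hs
      simp [jacket]
    · rcases Int.units_eq_one_or s with rfl | rfl
      · refine Quot.sound ?_
        simp [jacket, r]
      · refine Quot.sound ?_
        simp [jacket, r]
  · rintro ⟨c, v⟩ ⟨c', w⟩ ⟨h, h'⟩
    dsimp only at h h'
    subst h
    rcases h' with rfl | rfl
    · exact Quot.sound (Or.inr (by simp [jacket]))
    · have e : ∀ u, Quot.mk (B.jacket σ 1).BoundaryStep ((u, c), 1) =
          Quot.mk _ ((u, σ c), -1) := fun u => Quot.sound (Or.inl (by simp [jacket]))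
      rw [e, e]
      exact Quot.sound (Or.inr (by simp [jacket]))
  · rintro ⟨⟨v, c⟩, s⟩
    rcases Int.units_eq_one_or s with rfl | rfl
    · rfl
    · exact Quot.sound (Or.inl (by simp [jacket]))
  · rintro ⟨c, v⟩
    rfl

/-- The degree in terms of the numbers of components, of vertices and of two-coloured cycles. -/
theorem two_mul_degree [Fintype C] [DecidableEq C] [Finite V] (B : Bubble C V)
    (hC : 2 ≤ Fintype.card C) :
    2 * B.degree = (Fintype.card C - 1).factorial *
        (B.numComponents - (Nat.card V : ℝ) / 2 + Fintype.card C * Nat.card V / 4) -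
      (Fintype.card C - 2).factorial / 2 *
        ∑ c, ∑ c', if c = c' then (0 : ℝ) else B.numFaces c c' := by
  have : Nonempty C := Fintype.card_pos_iff.1 (by omega)
  have hgen : ∀ σ ∈ fullCycles C, (B.jacket σ 1).genus =
      (B.numComponents - (Nat.card V : ℝ) / 2 + Fintype.card C * Nat.card V / 4) -
        1 / 2 * ∑ c, ∑ c', if σ c = c' then (B.numFaces c c' : ℝ) else 0 := by
    intro σ hσ
    have hE : 2 * ((B.jacket σ 1).numEdges : ℝ) = Nat.card V * Fintype.card C := by
      exact_mod_cast B.numEdges_jacket σ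
    rw [EmbeddedGraph.genus, numVertices_jacket B hσ, numComponents_jacket B hσ, numFaces_jacket]
    simp only [Finset.sum_ite_eq, Finset.mem_univ, if_true]
    push_cast
    linarith
  have hsum : ∑ σ ∈ fullCycles C, ∑ c, ∑ c', (if σ c = c' then (B.numFaces c c' : ℝ) else 0) =
      (Fintype.card C - 2).factorial * ∑ c, ∑ c', if c = c' then (0 : ℝ) else B.numFaces c c' := by
    rw [Finset.sum_comm, Finset.mul_sum]
    refine Finset.sum_congr rfl fun c _ => ?_
    rw [Finset.sum_comm, Finset.mul_sum]
    refine Finset.sum_congr rfl fun c' _ => ?_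
    rw [← Finset.sum_filter, Finset.sum_const, card_fullCycles_apply_eq hC]
    split_ifs <;> simp
  have hdeg : B.degree = 1 / 2 * ∑ σ ∈ fullCycles C, (B.jacket σ 1).genus := by
    rw [degree, fullCycles]
  rw [hdeg, Finset.sum_congr rfl hgen, Finset.sum_sub_distrib, Finset.sum_const, ← Finset.mul_sum,
    hsum, card_fullCycles hC, nsmul_eq_mul]
  ring

/-- The index in terms of the numbers of components, of vertices and of two-coloured cycles. -/
theorem two_mul_index {R : ℕ} (hR : 2 ≤ R) [Finite V] (B : Bubble (Fin (R + 1)) V) :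
    2 * B.index = R * ((R : ℝ) - 1) *
        (B.numComponents - B.deleteZero.numComponents + (Nat.card V : ℝ) / 4) -
      ((R : ℝ) - 1) * ∑ i : Fin R, (B.numFaces 0 i.succ : ℝ) +
      1 / 2 * ∑ i : Fin R, ∑ j : Fin R, if i = j then (0 : ℝ) else B.numFaces i.succ j.succ := by
  have h1 := two_mul_degree B (by simpa using by omega)
  have h2 := two_mul_degree B.deleteZero (by simpa using hR)
  have hsplit : ∑ c : Fin (R + 1), ∑ c', (if c = c' then (0 : ℝ) else B.numFaces c c') =
      2 * ∑ i : Fin R, (B.numFaces 0 i.succ : ℝ) +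
        ∑ i : Fin R, ∑ j : Fin R, if i = j then (0 : ℝ) else B.numFaces i.succ j.succ := by
    simp only [Fin.sum_univ_succ, Fin.succ_inj, if_true, Finset.sum_add_distrib,
      Fin.succ_ne_zero, if_false, (Fin.succ_ne_zero _).symm, B.numFaces_comm _ 0]
    ring
  rw [hsplit] at h1
  have hface : ∀ i j, B.deleteZero.numFaces i j = B.numFaces i.succ j.succ := fun i j => rfl
  simp only [hface, Fintype.card_fin] at h1 h2
  obtain ⟨k, rfl⟩ := Nat.exists_eq_add_of_le' hR
  have e1 : k + 2 + 1 - 1 = k + 1 + 1 := rfl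
  have e2 : k + 2 + 1 - 2 = k + 1 := rfl
  have e3 : k + 2 - 1 = k + 1 := rfl
  have e4 : k + 2 - 2 = k := rfl
  rw [e1, e2, Nat.factorial_succ, Nat.factorial_succ] at h1
  rw [e3, e4, Nat.factorial_succ] at h2
  have hk : (k.factorial : ℝ) ≠ 0 := by positivity
  rw [index, e4, mul_div_assoc', mul_sub, h1, mul_left_comm (2 : ℝ), h2]
  field_simp
  push_cast
  ring

/-- Summed over the pairs `i ≠ j` of non-zero colours, Euler's inequality for the colours `0, i, j`
and the submodularity of the number of components bound the index from below. -/
theorem index_nonneg {R : ℕ} (hR : 2 ≤ R) [Finite V] (B : Bubble (Fin (R + 1)) V) :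
    0 ≤ B.index := by
  -- Euler's inequality for the three colours `0`, `i`, `j`, and submodularity to compare the
  -- components of this three-coloured graph with those of the whole bubble.
  have key : ∀ i j : Fin R, 2 * (B.numFaces 0 i.succ : ℝ) + 2 * B.numFaces 0 j.succ ≤
      Nat.card V + 2 * B.numFaces i.succ j.succ +
        4 * ((B.numComponents : ℝ) - B.deleteZero.numComponents) := by
    intro i j
    have h1 := numClasses_three_involutions (B.nbr_nbr 0) (B.nbr_nbr i.succ) (B.nbr_nbr j.succ)
      (B.nbr_ne 0) (B.nbr_ne i.succ) (B.nbr_ne j.succ)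
    have h2 := numClasses_submodular (fun v w => B.nbr 0 v = w)
      (fun v w => B.nbr i.succ v = w ∨ B.nbr j.succ v = w)
      (fun v w => ∃ c, B.deleteZero.nbr c v = w)
      (fun v w h => h.elim (fun h => ⟨i, h⟩) fun h => ⟨j, h⟩)
    have h3 : numClasses (fun v w => B.nbr 0 v = w ∨ ∃ c, B.deleteZero.nbr c v = w) =
        B.numComponents :=
      numClasses_iff fun v w => by rw [Fin.exists_fin_succ]; rfl
    have h4 : numClasses (fun v w => B.nbr 0 v = w ∨ B.nbr i.succ v = w ∨ B.nbr j.succ v = w) =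
        numClasses (fun v w => (B.nbr 0 v = w ∨ B.nbr i.succ v = w) ∨ B.nbr j.succ v = w) :=
      numClasses_iff fun v w => or_assoc.symm
    rw [h3, h4] at h2
    change 2 * (B.numFaces 0 i.succ + B.numFaces 0 j.succ + B.numFaces i.succ j.succ) ≤ _ at h1
    change B.deleteZero.numComponents + _ ≤ B.numFaces i.succ j.succ + _ at h2
    have h5 : 2 * B.numFaces 0 i.succ + 2 * B.numFaces 0 j.succ + 4 * B.deleteZero.numComponents ≤
      Nat.card V + 2 * B.numFaces i.succ j.succ + 4 * B.numComponents := by omega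
    have h6 : 2 * (B.numFaces 0 i.succ : ℝ) + 2 * B.numFaces 0 j.succ +
        4 * B.deleteZero.numComponents ≤
      Nat.card V + 2 * B.numFaces i.succ j.succ + 4 * B.numComponents := by exact_mod_cast h5
    linarith
  have hsum := Finset.sum_le_sum fun i (_ : i ∈ (Finset.univ : Finset (Fin R))) =>
    Finset.sum_le_sum fun j (_ : j ∈ Finset.univ.filter fun j => ¬ i = j) => key i j
  have hcard : ∀ i : Fin R, ((Finset.univ.filter fun j => ¬ i = j).card : ℝ) = (R : ℝ) - 1 := by
    intro i
    rw [Finset.filter_not, Finset.filter_eq, if_pos (Finset.mem_univ _), Finset.card_sdiff_of_subset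
      (Finset.subset_univ _), Finset.card_singleton, Finset.card_univ, Fintype.card_fin,
      Nat.cast_sub (by omega), Nat.cast_one]
  have hswap : ∑ i : Fin R, ∑ j with ¬ i = j, 2 * (B.numFaces 0 j.succ : ℝ) =
      ∑ i : Fin R, ∑ j with ¬ i = j, 2 * (B.numFaces 0 i.succ : ℝ) := by
    simp only [Finset.sum_filter]
    rw [Finset.sum_comm]
    simp only [eq_comm]
  simp only [Finset.sum_add_distrib] at hsum
  rw [hswap] at hsum
  simp only [Finset.sum_const, nsmul_eq_mul, hcard, Finset.card_univ,
    Fintype.card_fin, ← Finset.mul_sum, Finset.sum_filter, ite_not] at hsum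
  have := two_mul_index hR B
  linarith

end Bubble

/-! ### Power counting for Feynman graphs -/

section Model

variable {R : ℕ} {S : Type*} {W : S → Type*} {B : ∀ a, Bubble (Fin R) (W a)}
  {I : Type*} {t : I → S}

theorem numComponents_interactionBubble [∀ a, Fintype (W a)] [Fintype I]
    (B : ∀ a, Bubble (Fin R) (W a)) (t : I → S) :
    (interactionBubble B t).numComponents = ∑ i, (B (t i)).numComponents := by
  refine numClasses_sigma _ ?_ ?_
  · rintro x _ ⟨c, rfl⟩
    rfl
  · intro i x y
    simp [interactionBubble]

theorem numFaces_interactionBubble [∀ a, Fintype (W a)] [Fintype I]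
    (B : ∀ a, Bubble (Fin R) (W a)) (t : I → S) (c c' : Fin R) :
    (interactionBubble B t).numFaces c c' = ∑ i, (B (t i)).numFaces c c' := by
  refine numClasses_sigma _ ?_ ?_
  · rintro x _ (rfl | rfl) <;> rfl
  · intro i x y
    simp [interactionBubble]

theorem degree_interactionBubble [∀ a, Fintype (W a)] [Fintype I] (hR : 2 ≤ R)
    (B : ∀ a, Bubble (Fin R) (W a)) (t : I → S) :
    (interactionBubble B t).degree = ∑ i, (B (t i)).degree := by
  have hcard : (Nat.card (Σ i, W (t i)) : ℝ) = ∑ i, (Nat.card (W (t i)) : ℝ) := by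
    rw [Nat.card_sigma, Nat.cast_sum]
  have hF : ∑ c : Fin R, ∑ c', (if c = c' then (0 : ℝ) else (interactionBubble B t).numFaces c c') =
      ∑ i, ∑ c : Fin R, ∑ c', if c = c' then (0 : ℝ) else (B (t i)).numFaces c c' := by
    rw [Finset.sum_comm (s := (Finset.univ : Finset I))]
    refine Finset.sum_congr rfl fun c _ => ?_
    rw [Finset.sum_comm (s := (Finset.univ : Finset I))]
    refine Finset.sum_congr rfl fun c' _ => ?_
    by_cases h : c = c'
    · simp [h]
    · simp only [h, if_false]
      rw [numFaces_interactionBubble, Nat.cast_sum]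
  have h1 := Bubble.two_mul_degree (interactionBubble B t) (by simpa using hR)
  have h2 := Fintype.sum_congr (fun i => 2 * (B (t i)).degree) _ fun i =>
    Bubble.two_mul_degree (B (t i)) (by simpa using hR)
  rw [hF, hcard, numComponents_interactionBubble, Nat.cast_sum] at h1
  rw [Finset.sum_sub_distrib, ← Finset.mul_sum, ← Finset.mul_sum, Finset.sum_add_distrib,
    Finset.sum_sub_distrib, ← Finset.sum_div, ← Finset.sum_div, ← Finset.mul_sum,
    ← Finset.mul_sum] at h2
  linarith

namespace FeynmanGraph

theorem deleteZero_bubble (G : FeynmanGraph B t) :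
    G.bubble.deleteZero = interactionBubble B t := rfl

theorem two_mul_numPropagators [∀ a, Fintype (W a)] [Fintype I] (G : FeynmanGraph B t) :
    2 * G.numPropagators = Nat.card (Σ i, W (t i)) :=
  numClasses_involution _ G.wick_wick G.wick_ne

/-- The stranded loops are the cycles of the bubble of the graph with colours `0` and `c`. -/
theorem numStrandedLoops_eq [∀ a, Fintype (W a)] [Fintype I] (G : FeynmanGraph B t) :
    G.numStrandedLoops = ∑ c : Fin R, G.bubble.numFaces 0 c.succ := by
  refine numClasses_prod _ ?_ ?_
  · rintro x _ (rfl | rfl) <;> rfl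
  · intro c x y
    simp only [Prod.mk.injEq, true_and]
    rw [or_comm, eq_comm, eq_comm (b := (interactionBubble B t).nbr c x)]
    rfl

theorem ell_eq [∀ a, Fintype (W a)] [Fintype I] (hR : 2 ≤ R) (G : FeynmanGraph B t) :
    G.ell = 2 * G.bubble.index + R * ((R : ℝ) - 1) *
      (1 + ∑ i, (((B (t i)).numComponents : ℝ) - 1) - G.bubble.numComponents) := by
  have h1 := Bubble.two_mul_index hR G.bubble
  have h2 := Bubble.two_mul_degree (interactionBubble B t) (by simpa using hR)
  have h3 : 2 * (G.numPropagators : ℝ) = Nat.card (Σ i, W (t i)) := by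
    exact_mod_cast G.two_mul_numPropagators
  have h4 : (G.numStrandedLoops : ℝ) = ∑ c : Fin R, (G.bubble.numFaces 0 c.succ : ℝ) := by
    rw [numStrandedLoops_eq, Nat.cast_sum]
  have hface : ∀ i j, G.bubble.numFaces i.succ j.succ = (interactionBubble B t).numFaces i j :=
    fun i j => rfl
  simp only [hface, deleteZero_bubble, ← h4, ← h3] at h1
  rw [← h3, Fintype.card_fin] at h2
  rw [ell, h1, ← Nat.cast_sum, Finset.sum_sub_distrib, ← Nat.cast_sum,
    ← numComponents_interactionBubble, ← degree_interactionBubble hR, Finset.sum_const,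
    Finset.card_univ, nsmul_eq_mul, mul_one]
  obtain ⟨k, rfl⟩ := Nat.exists_eq_add_of_le' hR
  have e3 : k + 2 - 1 = k + 1 := rfl
  have e4 : k + 2 - 2 = k := rfl
  rw [e3, e4, Nat.factorial_succ] at h2
  rw [e3, div_mul_eq_mul_div, h2, Nat.factorial_succ]
  have hk : (k.factorial : ℝ) ≠ 0 := by positivity
  field_simp
  push_cast
  ring

/-- Joining the interaction vertices of a connected graph takes `Fintype.card I - 1` merges, and the
propagators merge at least as many components of the interaction bubbles. -/
theorem numComponents_bubble_le [∀ a, Fintype (W a)] [Fintype I] (G : FeynmanGraph B t)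
    (hG : G.IsConnected) :
    Fintype.card I + G.bubble.numComponents ≤ 1 + ∑ i, (B (t i)).numComponents := by
  rw [← numComponents_interactionBubble]
  set Z := invariants fun x y => G.wick x = y
  set Q := invariants fun x y => ∃ c, (interactionBubble B t).nbr c x = y with hQ
  have hc : G.bubble.numComponents = finrank (ZMod 2) ↥(Z ⊓ Q) := by
    rw [← numClasses_or]
    refine numClasses_iff fun v w => ?_
    rw [Fin.exists_fin_succ]
    rfl
  have hc0 : (interactionBubble B t).numComponents = finrank (ZMod 2) Q :=
    (finrank_invariants _).symm
  -- Functions of the interaction vertices, viewed as functions of the fields modulo those which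
  -- are invariant under the propagators.
  let pull : (I → ZMod 2) →ₗ[ZMod 2] Q :=
    { toFun := fun f => ⟨fun x => f x.1, by rintro x _ ⟨c, rfl⟩; rfl⟩
      map_add' := fun f g => rfl
      map_smul' := fun k f => rfl }
  let T : Submodule (ZMod 2) Q := Z.comap Q.subtype
  have hT : finrank (ZMod 2) T = finrank (ZMod 2) ↥(Z ⊓ Q) := by
    rw [inf_comm, ← Submodule.map_comap_subtype, Submodule.finrank_map_subtype_eq]
  let φ := T.mkQ.comp pull
  have hker : LinearMap.ker φ = invariants (fun i j : I => ∃ x, x.1 = i ∧ (G.wick x).1 = j) := by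
    ext f
    rw [LinearMap.mem_ker, LinearMap.comp_apply, Submodule.mkQ_apply, Submodule.Quotient.mk_eq_zero]
    constructor
    · rintro h _ _ ⟨x, rfl, rfl⟩
      exact h x _ rfl
    · rintro h x _ rfl
      exact h _ _ ⟨x, rfl, rfl⟩
  have h1 := φ.finrank_range_add_finrank_ker
  rw [hker, finrank_invariants, show numClasses _ = 1 from hG, finrank_fintype_fun_eq_card] at h1
  have h2 := Submodule.finrank_le (LinearMap.range φ)
  have h3 := Submodule.finrank_quotient_add_finrank T
  omega

theorem ell_nonneg [∀ a, Fintype (W a)] [Fintype I] (hR : 2 ≤ R) (G : FeynmanGraph B t)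
    (hG : G.IsConnected) : 0 ≤ G.ell := by
  have h1 := Bubble.index_nonneg hR G.bubble
  have h2 : (Fintype.card I : ℝ) + G.bubble.numComponents ≤
      1 + ∑ i, ((B (t i)).numComponents : ℝ) := by exact_mod_cast numComponents_bubble_le G hG
  have hR' : (1 : ℝ) ≤ R := by exact_mod_cast (by omega : 1 ≤ R)
  rw [ell_eq hR, Finset.sum_sub_distrib, Finset.sum_const, Finset.card_univ, nsmul_eq_mul, mul_one]
  have := mul_nonneg (mul_nonneg (by linarith : (0 : ℝ) ≤ R) (by linarith : (0 : ℝ) ≤ R - 1))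
    (by linarith : (0 : ℝ) ≤ 1 + (∑ i, ((B (t i)).numComponents : ℝ) - Fintype.card I)
      - G.bubble.numComponents)
  linarith

/-- Integrality holds since `R * (R - 1)` is even and the sum over the ordered pairs of colours
counts every two-coloured cycle twice. -/
theorem exists_ell_eq_intCast [∀ a, Fintype (W a)] [Fintype I] (hR : 2 ≤ R)
    (G : FeynmanGraph B t) : ∃ l : ℤ, G.ell = l := by
  have h1 := Bubble.two_mul_index hR G.bubble
  have h3 : 2 * (G.numPropagators : ℝ) = Nat.card (Σ i, W (t i)) := by
    exact_mod_cast G.two_mul_numPropagators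
  obtain ⟨m, hm⟩ := Nat.even_mul_pred_self R
  have hm' : (R : ℝ) * ((R : ℝ) - 1) = m + m := by
    rw [← Nat.cast_one, ← Nat.cast_sub (by omega), ← Nat.cast_mul, hm, Nat.cast_add]
  have hF : ∑ i : Fin R, ∑ j : Fin R, (if i = j then (0 : ℝ) else G.bubble.numFaces i.succ j.succ) =
      2 * ∑ i : Fin R, ∑ j : Fin R, if i < j then (G.bubble.numFaces i.succ j.succ : ℝ) else 0 := by
    rw [two_mul]
    nth_rewrite 3 [Finset.sum_comm]
    rw [← Finset.sum_add_distrib]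
    refine Finset.sum_congr rfl fun i _ => ?_
    rw [← Finset.sum_add_distrib]
    refine Finset.sum_congr rfl fun j _ => ?_
    rw [G.bubble.numFaces_comm j.succ]
    rcases lt_trichotomy i j with h | h | h
    · simp [h, h.ne, h.not_gt]
    · simp [h]
    · simp [h, h.ne', h.not_gt]
  rw [ell_eq hR, h1, hF, ← h3, hm']
  refine ⟨(m + m) * (G.bubble.numComponents - G.bubble.deleteZero.numComponents) +
    m * G.numPropagators - (R - 1) * ∑ i : Fin R, (G.bubble.numFaces 0 i.succ : ℤ) +
    (∑ i : Fin R, ∑ j : Fin R, if i < j then (G.bubble.numFaces i.succ j.succ : ℤ) else 0) +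
    (m + m) * (1 + ∑ i, (((B (t i)).numComponents : ℤ) - 1) - G.bubble.numComponents), ?_⟩
  push_cast
  ring

theorem exists_ell_eq_natCast [∀ a, Fintype (W a)] [Fintype I] (hR : 2 ≤ R)
    (G : FeynmanGraph B t) (hG : G.IsConnected) : ∃ l : ℕ, G.ell = l := by
  obtain ⟨l, hl⟩ := exists_ell_eq_intCast hR G
  have h0 := ell_nonneg hR G hG
  rw [hl] at h0
  lift l to ℕ using by exact_mod_cast h0
  exact ⟨l, by simpa using hl⟩

/-- The sum over the indices contributes a factor `N` for each stranded loop. -/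
theorem amplitude_eq [∀ a, Fintype (W a)] [Fintype I] (G : FeynmanGraph B t) (N : ℕ)
    (lam : S → ℝ) :
    G.amplitude N lam = (∏ i, -enhancedCoupling B N lam (t i)) *
      (1 / (N : ℝ) ^ (R - 1)) ^ G.numPropagators * (N : ℝ) ^ G.numStrandedLoops := by
  classical
  rw [amplitude]
  congr 1
  rw [Finset.sum_boole]
  set r : Fin R × (Σ i, W (t i)) → Fin R × (Σ i, W (t i)) → Prop := fun x y =>
    y = (x.1, (interactionBubble B t).nbr x.1 x.2) ∨ y = (x.1, G.wick x.2)
  have e : {j : (Σ i, W (t i)) → Fin R → Fin N //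
      (∀ c x, j ((interactionBubble B t).nbr c x) c = j x c) ∧ ∀ x, j (G.wick x) = j x} ≃
      (Quot r → Fin N) :=
    { toFun := fun j => Quot.lift (fun x => j.1 x.2 x.1) (by
        rintro x _ (rfl | rfl)
        · exact (j.2.1 _ _).symm
        · exact (congrFun (j.2.2 x.2) x.1).symm)
      invFun := fun g => ⟨fun x c => g (Quot.mk r (c, x)),
        fun c x => congrArg g (Quot.sound (r := r) (a := (c, x)) (Or.inl rfl)).symm,
        fun x => funext fun c => congrArg g (Quot.sound (r := r) (a := (c, x)) (Or.inr rfl)).symm⟩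
      left_inv := fun j => rfl
      right_inv := fun g => by ext ⟨x⟩; rfl }
  rw [← Fintype.card_subtype, ← Nat.card_eq_fintype_card, Nat.card_congr e, Nat.card_fun,
    Nat.card_fin, Nat.cast_pow]
  rfl

theorem amplitude_eq_rpow [∀ a, Fintype (W a)] [Fintype I] (hR : 2 ≤ R) (G : FeynmanGraph B t)
    {N : ℕ} (hN : 1 ≤ N) (lam : S → ℝ) :
    G.amplitude N lam = (∏ i, -lam (t i)) * (N : ℝ) ^ ((R : ℝ) - G.ell / ((R : ℝ) - 1)) := by
  have hN' : (0 : ℝ) < N := by exact_mod_cast hN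
  have hR' : (R : ℝ) - 1 ≠ 0 := by
    have : (2 : ℝ) ≤ R := by exact_mod_cast hR
    linarith
  have h1 : ∏ i, -enhancedCoupling B N lam (t i) = (∏ i, -lam (t i)) *
      (N : ℝ) ^ ∑ i, ((R : ℝ) - (B (t i)).numComponents +
        2 / (R - 1).factorial * (B (t i)).degree) := by
    rw [Real.rpow_sum_of_pos hN', ← Finset.prod_mul_distrib]
    refine Finset.prod_congr rfl fun i _ => ?_
    rw [enhancedCoupling]
    ring
  rw [amplitude_eq, h1, one_div, inv_pow, ← pow_mul, ← Real.rpow_natCast, ← Real.rpow_neg hN'.le,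
    ← Real.rpow_natCast (n := G.numStrandedLoops), mul_assoc, mul_assoc, ← Real.rpow_add hN',
    ← Real.rpow_add hN']
  congr 2
  rw [ell, mul_div_cancel_left₀ _ hR', Finset.sum_add_distrib, Finset.sum_sub_distrib,
    Finset.sum_const, Finset.card_univ, nsmul_eq_mul, ← Finset.mul_sum]
  push_cast [Nat.cast_sub (show 1 ≤ R by omega)]
  ring

end FeynmanGraph

end Model

open MeasureTheory ProbabilityTheory

/-! ### Gaussian moments and Wick's theorem -/

theorem integrable_pow_gaussianReal (v : NNReal) (k : ℕ) :
    Integrable (fun x : ℝ => x ^ k) (gaussianReal 0 v) := by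
  have h := (memLp_id_gaussianReal (μ := 0) (v := v) k).integrable_norm_pow'
  refine (integrable_norm_iff (by fun_prop)).1 ?_
  simpa using h

theorem integrable_gaussianPDFReal_mul_pow {v : NNReal} (hv : v ≠ 0) (k : ℕ) :
    Integrable fun x : ℝ => x ^ k * gaussianPDFReal 0 v x := by
  have h := integrable_pow_gaussianReal v k
  rw [gaussianReal_of_var_ne_zero 0 hv, integrable_withDensity_iff_integrable_smul'
    (measurable_gaussianPDF 0 v) (ae_of_all _ fun _ => gaussianPDF_lt_top)] at h
  refine h.congr (ae_of_all _ fun x => ?_)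
  simp only [toReal_gaussianPDF, smul_eq_mul, mul_comm]

theorem hasDerivAt_gaussianPDFReal {v : NNReal} (hv : v ≠ 0) (x : ℝ) :
    HasDerivAt (gaussianPDFReal 0 v) (-(x * gaussianPDFReal 0 v x) / v) x := by
  have hv' : (v : ℝ) ≠ 0 := by exact_mod_cast hv
  rw [gaussianPDFReal_def]
  have h : HasDerivAt (fun x : ℝ => -(x - 0) ^ 2 / (2 * (v : ℝ))) (-x / v) x := by
    have := ((((hasDerivAt_id x).sub_const 0).pow 2).neg).div_const (2 * (v : ℝ))
    refine this.congr_deriv ?_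
    simp
    field_simp
  refine (h.exp.const_mul _).congr_deriv ?_
  ring

/-- The recursion for the moments of a centred Gaussian, by integration by parts. -/
theorem integral_pow_gaussianReal {v : NNReal} (hv : v ≠ 0) (k : ℕ) :
    ∫ x, x ^ (k + 1) ∂gaussianReal 0 v = k * v * ∫ x, x ^ (k - 1) ∂gaussianReal 0 v := by
  have hv' : (v : ℝ) ≠ 0 := by exact_mod_cast hv
  have h := integral_mul_deriv_eq_deriv_mul_of_integrable (u := fun x : ℝ => x ^ k)
    (u' := fun x : ℝ => k * x ^ (k - 1)) (v := gaussianPDFReal 0 v)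
    (v' := fun x => -(x * gaussianPDFReal 0 v x) / v)
    (fun x _ => hasDerivAt_pow k x) (fun x _ => hasDerivAt_gaussianPDFReal hv x)
    (((integrable_gaussianPDFReal_mul_pow hv (k + 1)).div_const (v : ℝ)).neg.congr
      (ae_of_all _ fun x => by simp only [Pi.neg_apply, Pi.mul_apply]; ring))
    (((integrable_gaussianPDFReal_mul_pow hv (k - 1)).const_mul (k : ℝ)).congr
      (ae_of_all _ fun x => by simp only [Pi.mul_apply]; ring))
    ((integrable_gaussianPDFReal_mul_pow hv k).congr (ae_of_all _ fun x => rfl))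
  rw [integral_gaussianReal_eq_integral_smul hv, integral_gaussianReal_eq_integral_smul hv]
  have e1 : ∫ x : ℝ, x ^ k * (-(x * gaussianPDFReal 0 v x) / v) =
      -(1 / v) * ∫ x : ℝ, gaussianPDFReal 0 v x • x ^ (k + 1) := by
    rw [← integral_const_mul]
    refine integral_congr_ae (ae_of_all _ fun x => ?_)
    simp only [smul_eq_mul]
    ring
  have e2 : ∫ x : ℝ, k * x ^ (k - 1) * gaussianPDFReal 0 v x =
      k * ∫ x : ℝ, gaussianPDFReal 0 v x • x ^ (k - 1) := by
    rw [← integral_const_mul]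
    refine integral_congr_ae (ae_of_all _ fun x => ?_)
    simp only [smul_eq_mul]
    ring
  rw [e1, e2] at h
  field_simp at h
  linarith

/-- The perfect matchings of `X` whose pairs consist of points with the same value of `j`, as
involutions without fixed points. -/
abbrev Pairing {X A : Type*} (j : X → A) : Type _ :=
  {f : X → X // (∀ x, f (f x) = x) ∧ (∀ x, f x ≠ x) ∧ ∀ x, j (f x) = j x}

/-- The pairings in which `y` is the partner of `x₀` are those of the remaining points. -/
theorem card_pairing_apply_eq {X A : Type*} (j : X → A) {x₀ y : X} (hy : y ≠ x₀)
    (hj : j y = j x₀) :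
    Nat.card {f : Pairing j // f.1 x₀ = y} =
      Nat.card (Pairing fun z : {z // z ≠ x₀ ∧ z ≠ y} => j z) := by
  classical
  refine Nat.card_congr
    { toFun := fun f => ⟨fun z => ⟨f.1.1 z, ?_, ?_⟩, ?_, ?_, ?_⟩
      invFun := fun g => ⟨⟨fun z => if h : z ≠ x₀ ∧ z ≠ y then g.1 ⟨z, h⟩ else
        if z = x₀ then y else x₀, ?_, ?_, ?_⟩, ?_⟩
      left_inv := ?_
      right_inv := ?_ }
  · intro h
    have h1 := f.1.2.1 z
    rw [h, f.2] at h1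
    exact z.2.2 h1.symm
  · intro h
    have h1 := f.1.2.1 z
    have h2 := f.1.2.1 x₀
    rw [f.2] at h2
    rw [h, h2] at h1
    exact z.2.1 h1.symm
  · intro z
    exact Subtype.ext (f.1.2.1 z)
  · intro z h
    exact f.1.2.2.1 z (congrArg Subtype.val h)
  · intro z
    exact f.1.2.2.2 z
  · intro z
    by_cases h : z ≠ x₀ ∧ z ≠ y
    · have h' := (g.1 ⟨z, h⟩).2
      simp only [dif_pos h, dif_pos h', Subtype.coe_eta, g.2.1]
    · by_cases h1 : z = x₀
      · subst h1
        simp [hy]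
      · have h2 : z = y := by tauto
        subst h2
        simp [h1]
  · intro z
    by_cases h : z ≠ x₀ ∧ z ≠ y
    · simp only [dif_pos h]
      exact fun h' => g.2.2.1 ⟨z, h⟩ (Subtype.ext h')
    · simp only [dif_neg h]
      split_ifs with h1
      · rw [h1]; exact hy
      · exact fun h2 => h1 h2.symm
  · intro z
    by_cases h : z ≠ x₀ ∧ z ≠ y
    · simp only [dif_pos h]
      exact g.2.2.2 ⟨z, h⟩
    · simp only [dif_neg h]
      split_ifs with h1
      · rw [h1]; exact hj
      · have h2 : z = y := by tauto
        rw [h2, hj]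
  · simp
  · rintro ⟨f, hf⟩
    apply Subtype.ext
    apply Subtype.ext
    funext z
    by_cases h : z ≠ x₀ ∧ z ≠ y
    · simp [h.1, h.2]
    · by_cases h1 : z = x₀
      · subst h1
        simp [hf]
      · have h2 : z = y := by tauto
        subst h2
        simp only [ne_eq, h1, not_false_eq_true, not_true_eq_false, and_false, dite_false, if_false]
        rw [← hf, f.2.1]
  · rintro g
    apply Subtype.ext
    funext z
    apply Subtype.ext
    simp [z.2.1, z.2.2]

theorem card_pairing {X A : Type*} [Fintype X] (j : X → A) (x₀ : X)
    [Fintype {y // y ≠ x₀ ∧ j y = j x₀}] :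
    Nat.card (Pairing j) = ∑ y : {y // y ≠ x₀ ∧ j y = j x₀},
      Nat.card (Pairing fun z : {z // z ≠ x₀ ∧ z ≠ y.1} => j z) := by
  rw [← Finset.sum_congr rfl fun y _ => card_pairing_apply_eq j y.2.1 y.2.2, ← Nat.card_sigma]
  exact Nat.card_congr
    { toFun := fun f => ⟨⟨f.1 x₀, f.2.2.1 x₀, f.2.2.2 x₀⟩, f, rfl⟩
      invFun := fun p => p.2.1
      left_inv := fun f => rfl
      right_inv := by
        rintro ⟨⟨y, hy⟩, f, h⟩
        dsimp only at h
        subst h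
        rfl }

open scoped Classical in
/-- A product of Gaussian moments counts pairings: both sides satisfy the same recursion
when a point is removed together with its partner. -/
theorem prod_gaussian_moments {A : Type*} [Fintype A] {v : NNReal} (hv : v ≠ 0) (n : ℕ) :
    ∀ {X : Type*} [Fintype X] (j : X → A), Fintype.card X = n →
    ∏ α, ∫ x, x ^ (Fintype.card {x // j x = α}) ∂gaussianReal 0 v =
      (v : ℝ) ^ (n / 2) * Nat.card (Pairing j) := by
  induction n using Nat.strong_induction_on with
  | _ n ih =>
  intro X _ j hn
  rcases isEmpty_or_nonempty X with hX | ⟨⟨x₀⟩⟩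
  · have h1 : ∀ α, Fintype.card {x // j x = α} = 0 := fun α => Fintype.card_eq_zero
    have h2 : n = 0 := by rw [← hn]; exact Fintype.card_eq_zero
    have h3 : Nat.card (Pairing j) = 1 := by
      rw [Nat.card_eq_one_iff_exists]
      exact ⟨⟨fun x => isEmptyElim x, fun x => isEmptyElim x, fun x => isEmptyElim x,
        fun x => isEmptyElim x⟩, fun f => Subtype.ext (funext fun x => isEmptyElim x)⟩
    simp only [h1, h2, h3]
    simp
  · set cnt : A → ℕ := fun α => Fintype.card {x // j x = α} with hcnt
    set M : ℕ → ℝ := fun k => ∫ x, x ^ k ∂gaussianReal 0 v with hM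
    have hpos : 0 < cnt (j x₀) := Fintype.card_pos_iff.2 ⟨⟨x₀, rfl⟩⟩
    have hnum : Fintype.card {y // y ≠ x₀ ∧ j y = j x₀} = cnt (j x₀) - 1 := by
      simp only [hcnt, Fintype.card_subtype]
      rw [← Finset.card_erase_of_mem (a := x₀) (by simp)]
      congr 1
      ext y
      simp
    have hterm : ∀ y : {y // y ≠ x₀ ∧ j y = j x₀},
        (v : ℝ) ^ (n / 2) * Nat.card (Pairing fun z : {z // z ≠ x₀ ∧ z ≠ y.1} => j z) =
          v * (M (cnt (j x₀) - 2) * ∏ α ∈ Finset.univ.erase (j x₀), M (cnt α)) := by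
      rintro ⟨y, hy, hjy⟩
      have hc : ∀ α, Fintype.card {z : {z // z ≠ x₀ ∧ z ≠ y} // j z = α} =
          ((Finset.univ.filter fun x => j x = α).erase x₀ |>.erase y).card := by
        intro α
        rw [Fintype.card_congr (Equiv.subtypeSubtypeEquivSubtypeInter _ fun z => j z = α),
          Fintype.card_subtype]
        congr 1
        ext z
        simp
        tauto
      have hcard : Fintype.card {z // z ≠ x₀ ∧ z ≠ y} = n - 2 := by
        have : (Finset.univ.filter fun z => z ≠ x₀ ∧ z ≠ y) = (Finset.univ.erase x₀).erase y := by
          ext z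
          simp
          tauto
        rw [Fintype.card_subtype, this, Finset.card_erase_of_mem (by simp [hy]),
          Finset.card_erase_of_mem (Finset.mem_univ _), Finset.card_univ, hn]
        omega
      have hn2 : 2 ≤ n := by
        rw [← hn]
        exact Nat.succ_le_of_lt (Fintype.one_lt_card_iff.2 ⟨y, x₀, hy⟩)
      have h := ih (n - 2) (by omega) (fun z : {z // z ≠ x₀ ∧ z ≠ y} => j z) hcard
      rw [← Finset.mul_prod_erase _ _ (Finset.mem_univ (j x₀))] at h
      have e1 : Fintype.card {z : {z // z ≠ x₀ ∧ z ≠ y} // j z = j x₀} = cnt (j x₀) - 2 := by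
        rw [hc, Finset.card_erase_of_mem (by simp [hy, hjy]), Finset.card_erase_of_mem (by simp),
          ← Fintype.card_subtype]
        rfl
      have e2 : ∀ α ∈ Finset.univ.erase (j x₀),
          ∫ x, x ^ (Fintype.card {z : {z // z ≠ x₀ ∧ z ≠ y} // j z = α}) ∂gaussianReal 0 v =
            M (cnt α) := by
        intro α hα
        have hα' := Finset.ne_of_mem_erase hα
        rw [hc, Finset.erase_eq_of_notMem, Finset.erase_eq_of_notMem, ← Fintype.card_subtype]
        · simpa using hα'.symm
        · simpa [hy, hjy] using hα'.symm
      rw [e1, Finset.prod_congr rfl e2] at h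
      rw [show n / 2 = (n - 2) / 2 + 1 by omega, pow_succ', mul_assoc, ← h]
    have hrec : M (cnt (j x₀)) = ((cnt (j x₀) - 1 : ℕ) : ℝ) * v * M (cnt (j x₀) - 2) := by
      have := integral_pow_gaussianReal hv (cnt (j x₀) - 1)
      rwa [Nat.sub_add_cancel hpos] at this
    rw [card_pairing j x₀, Nat.cast_sum, Finset.mul_sum, Finset.sum_congr rfl fun y _ => hterm y,
      Finset.sum_const, Finset.card_univ, hnum, nsmul_eq_mul,
      ← Finset.mul_prod_erase _ _ (Finset.mem_univ (j x₀))]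
    change M (cnt (j x₀)) * _ = _
    rw [hrec]
    ring

section

variable {A : Type*} [Fintype A] {X : Type*} [Fintype X]

open scoped Classical in
theorem prod_apply_eq_prod_pow (j : X → A) (T : A → ℝ) :
    ∏ x, T (j x) = ∏ α, T α ^ Fintype.card {x // j x = α} := by
  rw [← Finset.prod_fiberwise_of_maps_to (g := j) (t := Finset.univ) fun _ _ => Finset.mem_univ _]
  refine Finset.prod_congr rfl fun α _ => ?_
  rw [Finset.prod_congr rfl fun x hx => by rw [(Finset.mem_filter.1 hx).2], Finset.prod_const,
    Fintype.card_subtype]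

theorem integrable_prod_gaussian (v : NNReal) (j : X → A) :
    Integrable (fun T : A → ℝ => ∏ x, T (j x)) (Measure.pi fun _ => gaussianReal 0 v) := by
  classical
  simp only [prod_apply_eq_prod_pow]
  exact Integrable.fintype_prod (f := fun α x => x ^ Fintype.card {x // j x = α})
    fun α => integrable_pow_gaussianReal v _

/-- **Wick's theorem** for independent centred Gaussians of variance `v`. -/
theorem integral_prod_gaussian {v : NNReal} (hv : v ≠ 0) (j : X → A) :
    ∫ T : A → ℝ, ∏ x, T (j x) ∂(Measure.pi fun _ => gaussianReal 0 v) =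
      (v : ℝ) ^ (Fintype.card X / 2) * Nat.card (Pairing j) := by
  classical
  simp only [prod_apply_eq_prod_pow]
  rw [integral_fintype_prod_eq_prod (fun α x => x ^ Fintype.card {x // j x = α}),
    prod_gaussian_moments hv _ j rfl]

end

section Model

variable {R : ℕ} {S : Type*} {W : S → Type*} {B : ∀ a, Bubble (Fin R) (W a)}
  {I : Type*} {t : I → S}

theorem FeynmanGraph.ext_wick {G G' : FeynmanGraph B t} (h : G.wick = G'.wick) : G = G' := by
  cases G; cases G'; cases h; rfl

instance [∀ a, Fintype (W a)] [Finite I] : Finite (FeynmanGraph B t) :=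
  Finite.of_injective FeynmanGraph.wick fun _ _ h => FeynmanGraph.ext_wick h

noncomputable instance [∀ a, Fintype (W a)] [Finite I] : Fintype (FeynmanGraph B t) :=
  Fintype.ofFinite _

/-- The Gaussian moments of the interaction are sums over Feynman graphs. -/
theorem integral_prod_traceInvariant [∀ a, Fintype (W a)] [Fintype I] {N : ℕ} (hN : 1 ≤ N)
    (t : I → S) :
    ∫ T, ∏ i, -(enhancedCoupling B N 1 (t i) * traceInvariant (B (t i)) T) ∂gaussianTensor R N =
      ∑ G : FeynmanGraph B t, G.amplitude N 1 := by
  classical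
  set v : NNReal := 1 / (N : NNReal) ^ (R - 1) with hv
  have hv0 : v ≠ 0 := by
    have : (N : NNReal) ≠ 0 := by exact_mod_cast (by omega : N ≠ 0)
    positivity
  have hvR : (v : ℝ) = 1 / (N : ℝ) ^ (R - 1) := by simp [hv]
  let P : ((Σ i, W (t i)) → Fin R → Fin N) → Prop :=
    fun j => ∀ c x, j ((interactionBubble B t).nbr c x) c = j x c
  have hexp : ∀ T : (Fin R → Fin N) → ℝ,
      ∏ i, -(enhancedCoupling B N 1 (t i) * traceInvariant (B (t i)) T) =
        (∏ i, -enhancedCoupling B N 1 (t i)) *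
          ∑ j : (Σ i, W (t i)) → Fin R → Fin N, if P j then ∏ x, T (j x) else 0 := by
    intro T
    simp only [← neg_mul, traceInvariant]
    rw [Finset.prod_mul_distrib, Fintype.prod_sum]
    congr 1
    refine (Fintype.sum_equiv (Equiv.piCurry fun _ _ => Fin R → Fin N) _ _ fun j => ?_).symm
    rw [Fintype.prod_ite_zero, Fintype.prod_sigma]
    refine if_congr ?_ rfl rfl
    exact ⟨fun h i c x => h c ⟨i, x⟩, fun h c x => h x.1 c x.2⟩
  have hpair : ∀ j : (Σ i, W (t i)) → Fin R → Fin N,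
      (Nat.card (Pairing j) : ℝ) =
        ∑ G : FeynmanGraph B t, if ∀ x, j (G.wick x) = j x then 1 else 0 := by
    intro j
    rw [Finset.sum_boole, ← Fintype.card_subtype, ← Nat.card_eq_fintype_card]
    congr 1
    exact Nat.card_congr
      { toFun := fun f => ⟨⟨f.1, f.2.1, f.2.2.1⟩, f.2.2.2⟩
        invFun := fun G => ⟨G.1.wick, G.1.wick_wick, G.1.wick_ne, G.2⟩
        left_inv := fun f => rfl
        right_inv := fun G => rfl }
  simp only [hexp]
  rw [integral_const_mul, integral_finsetSum]
  · have hint : ∀ j : (Σ i, W (t i)) → Fin R → Fin N,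
        ∫ T, (if P j then ∏ x, T (j x) else 0) ∂gaussianTensor R N =
          if P j then (v : ℝ) ^ (Fintype.card (Σ i, W (t i)) / 2) * Nat.card (Pairing j) else 0 := by
      intro j
      by_cases h : P j
      · simp only [h, if_true]
        exact integral_prod_gaussian hv0 j
      · simp [h]
    have hamp : ∀ G : FeynmanGraph B t, G.amplitude N 1 = (∏ i, -enhancedCoupling B N 1 (t i)) *
        ∑ j : (Σ i, W (t i)) → Fin R → Fin N, if P j then
          (v : ℝ) ^ (Fintype.card (Σ i, W (t i)) / 2) *
            (if ∀ x, j (G.wick x) = j x then 1 else 0) else 0 := by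
      intro G
      have hp : G.numPropagators = Fintype.card (Σ i, W (t i)) / 2 := by
        have := G.two_mul_numPropagators
        rw [Nat.card_eq_fintype_card] at this
        omega
      rw [FeynmanGraph.amplitude, mul_assoc, ← hvR, hp, Finset.mul_sum]
      congr 1
      refine Finset.sum_congr rfl fun j _ => ?_
      rw [ite_and]
      split_ifs <;> simp
    simp only [hint, hamp, hpair]
    rw [← Finset.mul_sum, Finset.sum_comm]
    congr 1
    refine Finset.sum_congr rfl fun j _ => ?_
    split_ifs
    · rw [Finset.mul_sum]
    · simp
  · intro j _
    by_cases h : P j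
    · simp only [h, if_true]
      exact integrable_prod_gaussian v j
    · simp [h]

end Model

/-! ### Splitting off a connected component -/

section Model

variable {R : ℕ} {S : Type*} {W : S → Type*} {B : ∀ a, Bubble (Fin R) (W a)}
  {I : Type*} {t : I → S}

open scoped Classical in
/-- The fields of the interaction vertices in `A` and those of the other ones. -/
noncomputable def fieldSplit (W : S → Type*) (t : I → S) (A : Finset I) :
    (Σ i : {i // i ∈ A}, W (t i)) ⊕ (Σ i : {i // i ∉ A}, W (t i)) ≃ Σ i, W (t i) where
  toFun := Sum.elim (fun x => ⟨x.1.1, x.2⟩) (fun x => ⟨x.1.1, x.2⟩)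
  invFun x := if h : x.1 ∈ A then .inl ⟨⟨x.1, h⟩, x.2⟩ else .inr ⟨⟨x.1, h⟩, x.2⟩
  left_inv := by
    rintro (⟨⟨i, hi⟩, x⟩ | ⟨⟨i, hi⟩, x⟩)
    · simp [hi]
    · simp [hi]
  right_inv := by
    rintro ⟨i, x⟩
    by_cases h : i ∈ A <;> simp [h]

theorem fieldSplit_inl {A : Finset I} (x : Σ i : {i // i ∈ A}, W (t i)) :
    fieldSplit W t A (.inl x) = ⟨x.1.1, x.2⟩ := rfl

theorem fieldSplit_inr {A : Finset I} (x : Σ i : {i // i ∉ A}, W (t i)) :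
    fieldSplit W t A (.inr x) = ⟨x.1.1, x.2⟩ := rfl

namespace FeynmanGraph

/-- The disjoint union of a graph on `A` and a graph on the complement of `A`. -/
noncomputable def glue {A : Finset I} (G₁ : FeynmanGraph B fun i : {i // i ∈ A} => t i)
    (G₂ : FeynmanGraph B fun i : {i // i ∉ A} => t i) : FeynmanGraph B t where
  wick x := fieldSplit W t A (((fieldSplit W t A).symm x).map G₁.wick G₂.wick)
  wick_wick x := by
    obtain ⟨x | x, rfl⟩ := (fieldSplit W t A).surjective x <;> simp [G₁.wick_wick, G₂.wick_wick]
  wick_ne x := by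
    obtain ⟨x | x, rfl⟩ := (fieldSplit W t A).surjective x <;> simp [G₁.wick_ne, G₂.wick_ne]

section

variable {A : Finset I} (G₁ : FeynmanGraph B fun i : {i // i ∈ A} => t i)
  (G₂ : FeynmanGraph B fun i : {i // i ∉ A} => t i)

theorem glue_wick_inl (x) : (glue G₁ G₂).wick (fieldSplit W t A (.inl x)) =
    fieldSplit W t A (.inl (G₁.wick x)) := by simp [glue]

theorem glue_wick_inr (x) : (glue G₁ G₂).wick (fieldSplit W t A (.inr x)) =
    fieldSplit W t A (.inr (G₂.wick x)) := by simp [glue]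

theorem glue_injective : Function.Injective fun p :
    (FeynmanGraph B fun i : {i // i ∈ A} => t i) × (FeynmanGraph B fun i : {i // i ∉ A} => t i) =>
      glue p.1 p.2 := by
  rintro ⟨G₁, G₂⟩ ⟨G₁', G₂'⟩ h
  have h' : ∀ x, (glue G₁ G₂).wick x = (glue G₁' G₂').wick x := fun x =>
    congrFun (congrArg FeynmanGraph.wick h) x
  refine Prod.ext (ext_wick (funext fun x => ?_)) (ext_wick (funext fun x => ?_))
  · simpa [glue_wick_inl] using h' (fieldSplit W t A (.inl x))
  · simpa [glue_wick_inr] using h' (fieldSplit W t A (.inr x))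

theorem numPropagators_glue [∀ a, Fintype (W a)] [Fintype I] :
    (glue G₁ G₂).numPropagators = G₁.numPropagators + G₂.numPropagators := by
  refine numClasses_sum (fieldSplit W t A) _ _ ?_ ?_ ?_ ?_ <;> intro x y
  · simp [glue_wick_inl]
  · simp [glue_wick_inr]
  · simp [glue_wick_inl]
  · simp [glue_wick_inr]

theorem nbr_fieldSplit_inl (c : Fin R) (x : Σ i : {i // i ∈ A}, W (t i)) :
    (interactionBubble B t).nbr c (fieldSplit W t A (.inl x)) =
      fieldSplit W t A (.inl ((interactionBubble B fun i : {i // i ∈ A} => t i).nbr c x)) := rfl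

theorem nbr_fieldSplit_inr (c : Fin R) (x : Σ i : {i // i ∉ A}, W (t i)) :
    (interactionBubble B t).nbr c (fieldSplit W t A (.inr x)) =
      fieldSplit W t A (.inr ((interactionBubble B fun i : {i // i ∉ A} => t i).nbr c x)) := rfl

theorem numStrandedLoops_glue [∀ a, Fintype (W a)] [Fintype I] :
    (glue G₁ G₂).numStrandedLoops = G₁.numStrandedLoops + G₂.numStrandedLoops := by
  refine numClasses_sum ((Equiv.prodSumDistrib (Fin R) _ _).symm.trans
    ((Equiv.refl (Fin R)).prodCongr (fieldSplit W t A))) _ _ ?_ ?_ ?_ ?_ <;>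
    rintro ⟨c, x⟩ ⟨d, y⟩ <;>
    simp [glue_wick_inl, glue_wick_inr, nbr_fieldSplit_inl, nbr_fieldSplit_inr]

theorem amplitude_glue [∀ a, Fintype (W a)] [Fintype I] [DecidableEq I] (N : ℕ)
    (lam : S → ℝ) :
    (glue G₁ G₂).amplitude N lam = G₁.amplitude N lam * G₂.amplitude N lam := by
  have hprod : ∏ i, -enhancedCoupling B N lam (t i) =
      (∏ i : {i // i ∈ A}, -enhancedCoupling B N lam (t i)) *
        ∏ i : {i // i ∉ A}, -enhancedCoupling B N lam (t i) := by
    rw [← Fintype.prod_subtype_mul_prod_subtype (· ∈ A)]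
    congr!
  rw [amplitude_eq, amplitude_eq, amplitude_eq, numPropagators_glue, numStrandedLoops_glue, hprod]
  ring

end

/-- `A` is the set of interaction vertices of a connected component of `G`. -/
def IsComponent (G : FeynmanGraph B t) (A : Finset I) : Prop :=
  ∃ (G₁ : FeynmanGraph B fun i : {i // i ∈ A} => t i)
    (G₂ : FeynmanGraph B fun i : {i // i ∉ A} => t i), G₁.IsConnected ∧ glue G₁ G₂ = G

/-- Two interaction vertices are adjacent if they are joined by a propagator. -/
def Adj (G : FeynmanGraph B t) (i j : I) : Prop := ∃ x, x.1 = i ∧ (G.wick x).1 = j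

theorem isConnected_iff (G : FeynmanGraph B t) :
    G.IsConnected ↔ Subsingleton (Quot G.Adj) ∧ Nonempty (Quot G.Adj) :=
  Nat.card_eq_one_iff_unique

theorem IsComponent.mem_iff {G : FeynmanGraph B t} {A : Finset I} (h : G.IsComponent A) {i : I}
    (hi : i ∈ A) (j : I) : j ∈ A ↔ Quot.mk G.Adj j = Quot.mk G.Adj i := by
  obtain ⟨G₁, G₂, hc, rfl⟩ := h
  constructor
  · intro hj
    obtain ⟨hs, -⟩ := G₁.isConnected_iff.1 hc
    have h1 : ∀ a b, G₁.Adj a b →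
        Quot.mk (glue G₁ G₂).Adj a.1 = Quot.mk (glue G₁ G₂).Adj b.1 := by
      rintro _ _ ⟨x, rfl, rfl⟩
      refine Quot.sound ⟨fieldSplit W t A (.inl x), rfl, ?_⟩
      rw [glue_wick_inl]
      rfl
    exact congrArg (Quot.lift _ h1) (hs.elim (Quot.mk _ ⟨j, hj⟩) (Quot.mk _ ⟨i, hi⟩))
  · intro h
    have h1 : ∀ a b, (glue G₁ G₂).Adj a b → (a ∈ A) = (b ∈ A) := by
      rintro _ _ ⟨x, rfl, rfl⟩
      obtain ⟨x | x, rfl⟩ := (fieldSplit W t A).surjective x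
      · rw [glue_wick_inl, fieldSplit_inl, fieldSplit_inl]
        exact propext (iff_of_true x.1.2 (G₁.wick x).1.2)
      · rw [glue_wick_inr, fieldSplit_inr, fieldSplit_inr]
        exact propext (iff_of_false x.1.2 (G₂.wick x).1.2)
    have h2 : (j ∈ A) = (i ∈ A) := congrArg (Quot.lift (fun i => i ∈ A) h1) h
    rwa [h2]

theorem isComponent_of_mem_iff (G : FeynmanGraph B t) {A : Finset I} {i : I}
    (hA : ∀ j, j ∈ A ↔ Quot.mk G.Adj j = Quot.mk G.Adj i) : G.IsComponent A := by
  classical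
  have hw : ∀ x, (G.wick x).1 ∈ A ↔ x.1 ∈ A := by
    intro x
    rw [hA, hA]
    have : Quot.mk G.Adj x.1 = Quot.mk G.Adj (G.wick x).1 := Quot.sound ⟨x, rfl, rfl⟩
    rw [this]
  let G₁ : FeynmanGraph B fun i : {i // i ∈ A} => t i :=
    { wick := fun x => ⟨⟨(G.wick ⟨x.1.1, x.2⟩).1, (hw _).2 x.1.2⟩, (G.wick ⟨x.1.1, x.2⟩).2⟩
      wick_wick := fun x => (fieldSplit W t A).injective.comp Sum.inl_injective
        (G.wick_wick ⟨x.1.1, x.2⟩)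
      wick_ne := fun x h => G.wick_ne ⟨x.1.1, x.2⟩
        (congrArg (fun y => fieldSplit W t A (.inl y)) h) }
  let G₂ : FeynmanGraph B fun i : {i // i ∉ A} => t i :=
    { wick := fun x => ⟨⟨(G.wick ⟨x.1.1, x.2⟩).1, fun h => x.1.2 ((hw _).1 h)⟩,
        (G.wick ⟨x.1.1, x.2⟩).2⟩
      wick_wick := fun x => (fieldSplit W t A).injective.comp Sum.inr_injective
        (G.wick_wick ⟨x.1.1, x.2⟩)
      wick_ne := fun x h => G.wick_ne ⟨x.1.1, x.2⟩
        (congrArg (fun y => fieldSplit W t A (.inr y)) h) }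
  refine ⟨G₁, G₂, ?_, ext_wick (funext fun x => ?_)⟩
  · have hi : i ∈ A := (hA i).2 rfl
    have key : ∀ a : {i // i ∈ A}, Quot.mk G₁.Adj a = Quot.mk G₁.Adj ⟨i, hi⟩ := by
      rintro ⟨j, hj⟩
      -- The class in `A`, extended by `none` outside of `A`, is constant on the classes of `G`.
      let f : I → Option (Quot G₁.Adj) := fun j =>
        if h : j ∈ A then some (Quot.mk _ ⟨j, h⟩) else none
      have hf : ∀ a b, G.Adj a b → f a = f b := by
        rintro _ _ ⟨x, rfl, rfl⟩
        by_cases h : x.1 ∈ A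
        · have h' := (hw x).2 h
          simp only [f, dif_pos h, dif_pos h']
          exact congrArg some (Quot.sound ⟨⟨⟨x.1, h⟩, x.2⟩, rfl, rfl⟩)
        · have h' := fun h' => h ((hw x).1 h')
          simp only [f, dif_neg h, dif_neg h']
      have h1 : f j = f i := congrArg (Quot.lift f hf) ((hA j).1 hj)
      simpa [f, hj, hi] using h1
    rw [isConnected_iff]
    exact ⟨⟨by rintro ⟨a⟩ ⟨b⟩; rw [key a, key b]⟩, ⟨Quot.mk _ ⟨i, hi⟩⟩⟩
  · obtain ⟨x | x, rfl⟩ := (fieldSplit W t A).surjective x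
    · rw [glue_wick_inl]
      rfl
    · rw [glue_wick_inr]
      rfl

open scoped Classical in
/-- The connected components of a graph partition its interaction vertices. -/
theorem sum_card_component [Fintype I] (G : FeynmanGraph B t) :
    ∑ A : Finset I, (if G.IsComponent A then A.card else 0) = Fintype.card I := by
  have h1 : ∀ A : Finset I, (if G.IsComponent A then A.card else 0) =
      ∑ i, if i ∈ A ∧ G.IsComponent A then 1 else 0 := by
    intro A
    split_ifs with h <;> simp [h]
  simp only [h1]
  rw [Finset.sum_comm, ← Finset.card_univ, Finset.card_eq_sum_ones]
  refine Finset.sum_congr rfl fun i _ => ?_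
  rw [Finset.sum_eq_single (Finset.univ.filter fun j => Quot.mk G.Adj j = Quot.mk G.Adj i)]
  · have h2 : G.IsComponent (Finset.univ.filter fun j => Quot.mk G.Adj j = Quot.mk G.Adj i) :=
      G.isComponent_of_mem_iff (i := i) fun j => by simp
    rw [if_pos ⟨by simp, h2⟩]
  · intro A _ hA
    refine if_neg fun h => hA ?_
    ext j
    simp [h.2.mem_iff h.1]
  · intro h
    exact absurd (Finset.mem_univ _) h

end FeynmanGraph

/-- The sum of the amplitudes, for `λ = 1`, of the graphs with given interaction vertices. -/
noncomputable def graphSum [∀ a, Fintype (W a)] [Fintype I] (B : ∀ a, Bubble (Fin R) (W a))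
    (N : ℕ) (t : I → S) : ℝ := ∑ G : FeynmanGraph B t, G.amplitude N 1

open scoped Classical in
/-- The sum of the amplitudes, for `λ = 1`, of the connected graphs with given interaction
vertices. -/
noncomputable def connectedSum [∀ a, Fintype (W a)] [Fintype I] (B : ∀ a, Bubble (Fin R) (W a))
    (N : ℕ) (t : I → S) : ℝ := ∑ G : FeynmanGraph B t with G.IsConnected, G.amplitude N 1

/-- Mark an interaction vertex, and split off its connected component. -/
theorem card_mul_graphSum [∀ a, Fintype (W a)] [Fintype I] [DecidableEq I]
    (B : ∀ a, Bubble (Fin R) (W a)) (N : ℕ) (t : I → S) :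
    Fintype.card I * graphSum B N t = ∑ A : Finset I, A.card *
      (connectedSum B N (fun i : {i // i ∈ A} => t i) *
        graphSum B N fun i : {i // i ∉ A} => t i) := by
  classical
  have h1 : ∀ A : Finset I, connectedSum B N (fun i : {i // i ∈ A} => t i) *
      graphSum B N (fun i : {i // i ∉ A} => t i) =
        ∑ G : FeynmanGraph B t, if G.IsComponent A then G.amplitude N 1 else 0 := by
    intro A
    rw [connectedSum, graphSum, Finset.sum_mul_sum, ← Finset.sum_product', ← Finset.sum_filter]
    refine Finset.sum_bij (fun p _ => FeynmanGraph.glue p.1 p.2) ?_ ?_ ?_ ?_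
    · rintro ⟨G₁, G₂⟩ h
      simp only [Finset.mem_product, Finset.mem_filter, Finset.mem_univ, true_and, and_true] at h
      exact Finset.mem_filter.2 ⟨Finset.mem_univ _, G₁, G₂, h, rfl⟩
    · intro p _ q _ h
      exact FeynmanGraph.glue_injective h
    · intro G h
      obtain ⟨G₁, G₂, hc, rfl⟩ := (Finset.mem_filter.1 h).2
      exact ⟨(G₁, G₂), by simp [hc], rfl⟩
    · rintro ⟨G₁, G₂⟩ _
      exact (FeynmanGraph.amplitude_glue G₁ G₂ N 1).symm
  simp only [h1, Finset.mul_sum]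
  rw [Finset.sum_comm, graphSum, Finset.mul_sum]
  refine Finset.sum_congr rfl fun G _ => ?_
  rw [← G.sum_card_component, Nat.cast_sum, Finset.sum_mul]
  refine Finset.sum_congr rfl fun A _ => ?_
  split_ifs <;> simp

/-! ### Relabelling the interaction vertices -/

namespace FeynmanGraph

variable {J : Type*}

/-- The fields after a relabelling of the interaction vertices. -/
def fieldRelabel (W : S → Type*) (t : I → S) (e : J ≃ I) :
    (Σ j, W (t (e j))) ≃ Σ i, W (t i) := Equiv.sigmaCongrLeft (β := fun i => W (t i)) e

/-- The graphs on the interaction vertices `I` and on the relabelled ones `J` correspond to each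
other. -/
def relabel (e : J ≃ I) : FeynmanGraph B t ≃ FeynmanGraph B (fun j => t (e j)) where
  toFun G :=
    { wick := fun x => (fieldRelabel W t e).symm (G.wick (fieldRelabel W t e x))
      wick_wick := fun x => by simp [G.wick_wick]
      wick_ne := fun x h => by
        rw [Equiv.symm_apply_eq] at h
        exact G.wick_ne _ h }
  invFun G :=
    { wick := fun x => fieldRelabel W t e (G.wick ((fieldRelabel W t e).symm x))
      wick_wick := fun x => by simp [G.wick_wick]
      wick_ne := fun x h => by
        rw [← Equiv.eq_symm_apply] at h
        exact G.wick_ne _ h }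
  left_inv G := ext_wick (by simp)
  right_inv G := ext_wick (by simp)

theorem fieldRelabel_wick (e : J ≃ I) (G : FeynmanGraph B t) (x) :
    fieldRelabel W t e ((relabel e G).wick x) = G.wick (fieldRelabel W t e x) := by
  simp [relabel]

theorem fieldRelabel_fst (e : J ≃ I) (x) : (fieldRelabel W t e x).1 = e x.1 := rfl

theorem fieldRelabel_nbr (e : J ≃ I) (c : Fin R) (x) :
    fieldRelabel W t e ((interactionBubble B fun j => t (e j)).nbr c x) =
      (interactionBubble B t).nbr c (fieldRelabel W t e x) := rfl

theorem numPropagators_relabel (e : J ≃ I) (G : FeynmanGraph B t) :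
    (relabel e G).numPropagators = G.numPropagators := by
  refine numClasses_congr (fieldRelabel W t e) ?_ ?_
  · rintro x _ rfl
    exact .inl (fieldRelabel_wick e G x).symm
  · rintro x _ rfl
    left
    rw [← (fieldRelabel W t e).apply_eq_iff_eq, fieldRelabel_wick]
    simp

theorem numStrandedLoops_relabel (e : J ≃ I) (G : FeynmanGraph B t) :
    (relabel e G).numStrandedLoops = G.numStrandedLoops := by
  refine numClasses_congr ((Equiv.refl _).prodCongr (fieldRelabel W t e)) ?_ ?_
  · rintro ⟨c, x⟩ _ (rfl | rfl)
    · exact .inl (.inl rfl)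
    · refine .inl (.inr ?_)
      simp [fieldRelabel_wick]
  · rintro ⟨c, x⟩ _ (rfl | rfl)
    · refine .inl (.inl ?_)
      simp [Equiv.symm_apply_eq, fieldRelabel_nbr]
    · refine .inl (.inr ?_)
      simp [Equiv.symm_apply_eq, fieldRelabel_wick]

theorem isConnected_relabel (e : J ≃ I) (G : FeynmanGraph B t) :
    (relabel e G).IsConnected ↔ G.IsConnected := by
  unfold IsConnected
  rw [numClasses_congr e]
  · rintro _ _ ⟨x, rfl, rfl⟩
    exact .inl ⟨fieldRelabel W t e x, rfl, by rw [← fieldRelabel_wick, fieldRelabel_fst]⟩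
  · rintro _ _ ⟨x, rfl, rfl⟩
    obtain ⟨x, rfl⟩ := (fieldRelabel W t e).surjective x
    exact .inl ⟨x, by simp [fieldRelabel_fst], by
      rw [← fieldRelabel_wick, fieldRelabel_fst, Equiv.symm_apply_apply]⟩

theorem amplitude_relabel [∀ a, Fintype (W a)] [Fintype I] [Fintype J] (e : J ≃ I)
    (G : FeynmanGraph B t) (N : ℕ) (lam : S → ℝ) :
    (relabel e G).amplitude N lam = G.amplitude N lam := by
  rw [amplitude_eq, amplitude_eq, numPropagators_relabel, numStrandedLoops_relabel,
    e.prod_comp fun i => -enhancedCoupling B N lam (t i)]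

end FeynmanGraph

theorem graphSum_relabel [∀ a, Fintype (W a)] [Fintype I] {J : Type*} [Fintype J]
    (B : ∀ a, Bubble (Fin R) (W a)) (N : ℕ) (t : I → S) (e : J ≃ I) :
    graphSum B N (fun j => t (e j)) = graphSum B N t :=
  (Fintype.sum_equiv (FeynmanGraph.relabel e) _ _ fun G =>
    (FeynmanGraph.amplitude_relabel e G N 1).symm).symm

theorem connectedSum_relabel [∀ a, Fintype (W a)] [Fintype I] {J : Type*} [Fintype J]
    (B : ∀ a, Bubble (Fin R) (W a)) (N : ℕ) (t : I → S) (e : J ≃ I) :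
    connectedSum B N (fun j => t (e j)) = connectedSum B N t := by
  classical
  simp only [connectedSum, Finset.sum_filter]
  refine (Fintype.sum_equiv (FeynmanGraph.relabel e) _ _ fun G => ?_).symm
  rw [FeynmanGraph.amplitude_relabel]
  exact if_congr (FeynmanGraph.isConnected_relabel e G).symm rfl rfl

end Model

/-! ### Exponentials of multivariate power series -/

open Finset in
/-- The product rule for the operator which multiplies the coefficients of degree `k` by `k`. -/
theorem degree_mul_coeff_pow {S : Type*} [DecidableEq S] (G : MvPowerSeries S ℝ) (d : ℕ)
    (n : S →₀ ℕ) :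
    (n.degree : ℝ) * MvPowerSeries.coeff n (G ^ (d + 1)) =
      (d + 1) * ∑ p ∈ antidiagonal n, (p.1.degree : ℝ) * MvPowerSeries.coeff p.1 G *
        MvPowerSeries.coeff p.2 (G ^ d) := by
  let E : MvPowerSeries S ℝ → MvPowerSeries S ℝ := fun F n => (n.degree : ℝ) * F n
  have hE : ∀ F m, MvPowerSeries.coeff m (E F) = m.degree * MvPowerSeries.coeff m F :=
    fun F m => rfl
  have hmul : ∀ F H, E (F * H) = E F * H + F * E H := by
    intro F H
    ext m
    rw [map_add, hE, MvPowerSeries.coeff_mul, MvPowerSeries.coeff_mul, MvPowerSeries.coeff_mul,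
      mul_sum, ← sum_add_distrib]
    refine sum_congr rfl fun p hp => ?_
    rw [← mem_antidiagonal.1 hp, hE, hE, map_add]
    push_cast
    ring
  have hpow : ∀ d : ℕ, E (G ^ (d + 1)) = (d + 1 : ℝ) • (E G * G ^ d) := by
    intro d
    induction d with
    | zero => simp
    | succ d ih =>
      rw [pow_succ, hmul, ih]
      push_cast
      simp only [MvPowerSeries.smul_eq_C_mul, map_add, map_natCast, map_one]
      ring
  rw [← hE, hpow, map_smul, MvPowerSeries.coeff_mul, smul_eq_mul]
  simp only [hE]

theorem coeff_subst_exp {S : Type*} (G : MvPowerSeries S ℝ)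
    (hG : MvPowerSeries.constantCoeff G = 0) (n : S →₀ ℕ) {D : ℕ} (hD : n.degree < D) :
    MvPowerSeries.coeff n (PowerSeries.subst G (PowerSeries.exp ℝ)) =
      ∑ d ∈ Finset.range D, 1 / (d.factorial : ℝ) * MvPowerSeries.coeff n (G ^ d) := by
  rw [PowerSeries.coeff_subst (PowerSeries.HasSubst.of_constantCoeff_zero hG)]
  rw [finsum_eq_sum_of_support_subset (s := Finset.range D)]
  · refine Finset.sum_congr rfl fun d _ => ?_
    rw [PowerSeries.coeff_exp, smul_eq_mul]
    simp
  · intro d hd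
    by_contra h
    refine hd ?_
    simp only [Finset.coe_range, Set.mem_Iio, not_lt] at h
    have : MvPowerSeries.coeff n (G ^ d) = 0 := by
      refine MvPowerSeries.coeff_of_lt_order ?_
      refine lt_of_lt_of_le ?_ (MvPowerSeries.le_order_pow_of_constantCoeff_eq_zero d hG)
      exact_mod_cast hD.trans_le h
    simp [this]

/-- The recursion for the coefficients of an exponential. -/
theorem degree_mul_coeff_subst_exp {S : Type*} [DecidableEq S] (G : MvPowerSeries S ℝ)
    (hG : MvPowerSeries.constantCoeff G = 0) (n : S →₀ ℕ) :
    (n.degree : ℝ) * MvPowerSeries.coeff n (PowerSeries.subst G (PowerSeries.exp ℝ)) =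
      ∑ p ∈ Finset.HasAntidiagonal.antidiagonal n, (p.1.degree : ℝ) * MvPowerSeries.coeff p.1 G *
        MvPowerSeries.coeff p.2 (PowerSeries.subst G (PowerSeries.exp ℝ)) := by
  rw [coeff_subst_exp G hG n (D := n.degree + 2) (by omega), Finset.sum_range_succ', mul_add,
    Finset.mul_sum]
  have h0 : (n.degree : ℝ) * (1 / ((0 : ℕ).factorial : ℝ) * MvPowerSeries.coeff n (G ^ 0)) = 0 := by
    rw [pow_zero, MvPowerSeries.coeff_one]
    split_ifs with h <;> simp [h]
  have h1 : ∀ d : ℕ, (n.degree : ℝ) * (1 / ((d + 1).factorial : ℝ) *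
      MvPowerSeries.coeff n (G ^ (d + 1))) =
      ∑ p ∈ Finset.HasAntidiagonal.antidiagonal n, (p.1.degree : ℝ) * MvPowerSeries.coeff p.1 G *
        (1 / (d.factorial : ℝ) * MvPowerSeries.coeff p.2 (G ^ d)) := by
    intro d
    rw [mul_left_comm, degree_mul_coeff_pow, Nat.factorial_succ, Finset.mul_sum, Finset.mul_sum]
    refine Finset.sum_congr rfl fun p _ => ?_
    push_cast
    field_simp
  rw [h0, add_zero, Finset.sum_congr rfl fun d _ => h1 d, Finset.sum_comm]
  refine Finset.sum_congr rfl fun p hp => ?_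
  have hle : p.2.degree ≤ n.degree := by
    rw [← Finset.HasAntidiagonal.mem_antidiagonal.1 hp, map_add]
    omega
  rw [coeff_subst_exp G hG p.2 (D := n.degree + 1) (by omega), Finset.mul_sum]

/-- Formal exponentials are characterized by their recursion. -/
theorem subst_exp_eq_iff {S : Type*} [DecidableEq S] (G Z : MvPowerSeries S ℝ)
    (hG : MvPowerSeries.constantCoeff G = 0) :
    PowerSeries.subst G (PowerSeries.exp ℝ) = Z ↔
      MvPowerSeries.coeff 0 Z = 1 ∧ ∀ n : S →₀ ℕ, (n.degree : ℝ) * MvPowerSeries.coeff n Z =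
        ∑ p ∈ Finset.HasAntidiagonal.antidiagonal n, (p.1.degree : ℝ) * MvPowerSeries.coeff p.1 G *
          MvPowerSeries.coeff p.2 Z := by
  have h0 : MvPowerSeries.coeff 0 (PowerSeries.subst G (PowerSeries.exp ℝ)) = 1 := by
    rw [coeff_subst_exp G hG 0 (D := 1) (by simp)]
    simp
  constructor
  · rintro rfl
    exact ⟨h0, degree_mul_coeff_subst_exp G hG⟩
  · rintro ⟨hZ0, hZ⟩
    suffices ∀ k, ∀ n : S →₀ ℕ, n.degree = k →
        MvPowerSeries.coeff n (PowerSeries.subst G (PowerSeries.exp ℝ)) =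
          MvPowerSeries.coeff n Z from MvPowerSeries.ext fun n => this _ n rfl
    intro k
    induction k using Nat.strong_induction_on with
    | _ k ih =>
    intro n hn
    by_cases hk : k = 0
    · have : n = 0 := by rwa [hk, Finsupp.degree_eq_zero_iff] at hn
      rw [this, h0, hZ0]
    · have hk' : (n.degree : ℝ) ≠ 0 := by rw [hn]; exact_mod_cast hk
      refine mul_left_cancel₀ hk' ?_
      rw [degree_mul_coeff_subst_exp G hG, hZ]
      refine Finset.sum_congr rfl fun p hp => ?_
      by_cases hp1 : p.1.degree = 0
      · simp [hp1]
      · have hsum : p.1.degree + p.2.degree = n.degree := by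
          rw [← Finset.HasAntidiagonal.mem_antidiagonal.1 hp, map_add]
        rw [ih p.2.degree (by omega) p.2 rfl]

theorem subst_exp_injective {S : Type*} {G G' : MvPowerSeries S ℝ}
    (hG : MvPowerSeries.constantCoeff G = 0) (hG' : MvPowerSeries.constantCoeff G' = 0)
    (h : PowerSeries.subst G (PowerSeries.exp ℝ) = PowerSeries.subst G' (PowerSeries.exp ℝ)) :
    G = G' := by
  classical
  obtain ⟨h0, h1⟩ := (subst_exp_eq_iff G _ hG).1 rfl
  have h2 := ((subst_exp_eq_iff G' _ hG').1 h.symm).2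
  suffices ∀ k, ∀ n : S →₀ ℕ, n.degree = k → MvPowerSeries.coeff n G =
      MvPowerSeries.coeff n G' from MvPowerSeries.ext fun n => this _ n rfl
  intro k
  induction k using Nat.strong_induction_on with
  | _ k ih =>
  intro n hn
  by_cases hk : k = 0
  · have : n = 0 := by rwa [hk, Finsupp.degree_eq_zero_iff] at hn
    rw [this, MvPowerSeries.coeff_zero_eq_constantCoeff, hG, hG']
  · have hk' : (n.degree : ℝ) ≠ 0 := by rw [hn]; exact_mod_cast hk
    have h3 := (h1 n).symm.trans (h2 n)
    have hmem : (n, (0 : S →₀ ℕ)) ∈ Finset.HasAntidiagonal.antidiagonal n := by simp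
    rw [← Finset.add_sum_erase _ _ hmem, ← Finset.add_sum_erase _ _ hmem] at h3
    have h4 : ∀ p ∈ (Finset.HasAntidiagonal.antidiagonal n).erase (n, 0),
        MvPowerSeries.coeff p.1 G = MvPowerSeries.coeff p.1 G' := by
      rintro ⟨p, q⟩ hp
      obtain ⟨hne, hp⟩ := Finset.mem_erase.1 hp
      have hpq := Finset.HasAntidiagonal.mem_antidiagonal.1 hp
      have hq : q.degree ≠ 0 := by
        intro hq
        rw [Finsupp.degree_eq_zero_iff] at hq
        exact hne (by rw [hq] at hpq ⊢; simpa using hpq)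
      have hsum : p.degree + q.degree = n.degree := by rw [← hpq, map_add]
      exact ih _ (by omega) p rfl
    rw [Finset.sum_congr rfl fun p hp => by rw [h4 p hp]] at h3
    have h5 := add_right_cancel h3
    rw [h0, mul_one, mul_one] at h5
    exact mul_left_cancel₀ hk' h5

/-! ### Types of interaction vertices and the exponential formula -/

section Types

variable {S : Type*}

/-- The number of interaction vertices of each type. -/
noncomputable def typeCount {J : Type*} [Fintype J] (t : J → S) : S →₀ ℕ :=
  ∑ j, Finsupp.single (t j) 1

theorem typeCount_apply {J : Type*} [Fintype J] [DecidableEq S] (t : J → S) (a : S) :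
    typeCount t a = Fintype.card {j // t j = a} := by
  rw [typeCount, Finsupp.finsetSum_apply, Fintype.card_subtype, Finset.card_filter]
  simp only [Finsupp.single_apply]

theorem degree_typeCount {J : Type*} [Fintype J] (t : J → S) :
    (typeCount t).degree = Fintype.card J := by
  simp [typeCount, map_sum]

/-- The standard interaction vertices with `n a` of them of type `a`. -/
abbrev Labels (n : S →₀ ℕ) : Type _ := Σ a : n.support, Fin (n a)

/-- The types of the standard interaction vertices. -/
abbrev labelType (n : S →₀ ℕ) : Labels n → S := fun i => i.1.1

theorem exists_relabel {J : Type*} [Fintype J] (t : J → S) {n : S →₀ ℕ} (hn : typeCount t = n) :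
    ∃ e : J ≃ Labels n, ∀ j, labelType n (e j) = t j := by
  classical
  have h : ∀ a, Nonempty ({j // t j = a} ≃ Fin (n a)) := fun a =>
    ⟨Fintype.equivFinOfCardEq (by rw [← hn, typeCount_apply])⟩
  have e := fun a => Classical.choice (h a)
  let e' : (Σ a, Fin (n a)) ≃ Labels n :=
    { toFun := fun x => ⟨⟨x.1, Finsupp.mem_support_iff.2 fun h0 => by
        have := x.2.2; omega⟩, x.2⟩
      invFun := fun x => ⟨x.1.1, x.2⟩
      left_inv := fun x => rfl
      right_inv := fun x => rfl }
  exact ⟨((Equiv.sigmaFiberEquiv t).symm.trans (Equiv.sigmaCongrRight e)).trans e', fun j => rfl⟩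

theorem prod_labels {M : Type*} [CommMonoid M] (n : S →₀ ℕ) (f : S → M) :
    ∏ i : Labels n, f (labelType n i) = n.prod fun a k => f a ^ k := by
  rw [Fintype.prod_sigma]
  simp only [labelType, Finset.prod_const, Finset.card_univ, Fintype.card_fin]
  exact Finset.prod_coe_sort n.support fun a => f a ^ n a

theorem card_labels (n : S →₀ ℕ) : Fintype.card (Labels n) = n.degree := by
  rw [Fintype.card_sigma]
  simp only [Fintype.card_fin]
  exact Finset.sum_coe_sort n.support fun a => n a

theorem sum_single_labels (n : S →₀ ℕ) (A : Finset (Labels n)) [DecidableEq (Labels n)] :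
    ∑ i ∈ A, Finsupp.single (labelType n i) 1 + ∑ i ∈ Aᶜ, Finsupp.single (labelType n i) 1 = n := by
  classical
  rw [Finset.sum_add_sum_compl]
  ext a
  have := typeCount_apply (labelType n) a
  rw [typeCount] at this
  rw [this]
  by_cases ha : a ∈ n.support
  · have e : {i : Labels n // labelType n i = a} ≃ Fin (n a) :=
      { toFun := fun i => Fin.cast (congrArg n i.2) i.1.2
        invFun := fun k => ⟨⟨⟨a, ha⟩, k⟩, rfl⟩
        left_inv := by rintro ⟨⟨⟨b, hb⟩, k⟩, rfl⟩; rfl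
        right_inv := fun k => rfl }
    rw [Fintype.card_congr e, Fintype.card_fin]
  · rw [Finsupp.notMem_support_iff.1 ha, Fintype.card_eq_zero_iff]
    exact ⟨by rintro ⟨i, rfl⟩; exact ha i.1.2⟩

/-- The number of sets of standard interaction vertices with given numbers of each type. -/
theorem card_subsets_mul_factorial (n p q : S →₀ ℕ) (hpq : p + q = n) [DecidableEq S] :
    (Finset.univ.filter fun A : Finset (Labels n) =>
        ∑ i ∈ A, Finsupp.single (labelType n i) 1 = p).card *
      ((p.prod fun _ k => k.factorial) * q.prod fun _ k => k.factorial) =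
      n.prod fun _ k => k.factorial := by
  classical
  have hp : p.support ⊆ n.support := by
    intro a ha
    rw [Finsupp.mem_support_iff] at *
    rw [← hpq, Finsupp.add_apply]
    omega
  have hq : q.support ⊆ n.support := by
    intro a ha
    rw [Finsupp.mem_support_iff] at *
    rw [← hpq, Finsupp.add_apply]
    omega
  have hcount : ∀ (A : Finset (Labels n)) (a : n.support),
      (∑ i ∈ A, Finsupp.single (labelType n i) 1) a.1 =
        (Finset.univ.filter fun k => (⟨a, k⟩ : Labels n) ∈ A).card := by
    intro A a
    rw [Finsupp.finsetSum_apply]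
    simp only [Finsupp.single_apply]
    rw [← Finset.card_filter]
    symm
    refine Finset.card_bij (fun k _ => ⟨a, k⟩) ?_ ?_ ?_
    · intro k hk
      simpa using hk
    · intro k _ k' _ h
      simpa using h
    · rintro ⟨b, k⟩ h
      obtain ⟨h1, h2⟩ := Finset.mem_filter.1 h
      obtain rfl : b = a := Subtype.ext h2
      exact ⟨k, by simpa using h1, rfl⟩
  have hcard : (Finset.univ.filter fun A : Finset (Labels n) =>
      ∑ i ∈ A, Finsupp.single (labelType n i) 1 = p).card =
        ∏ a : n.support, (n a).choose (p a) := by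
    have : ∏ a : n.support, (n a).choose (p a) = (Fintype.piFinset fun a : n.support =>
        (Finset.univ : Finset (Fin (n a))).powersetCard (p a)).card := by
      rw [Fintype.card_piFinset]
      simp
    rw [this]
    refine Finset.card_bij' (fun A _ a => Finset.univ.filter fun k => (⟨a, k⟩ : Labels n) ∈ A)
      (fun F _ => Finset.univ.sigma F) ?_ ?_ ?_ ?_
    · intro A hA
      rw [Fintype.mem_piFinset]
      intro a
      rw [Finset.mem_powersetCard, ← hcount, (Finset.mem_filter.1 hA).2]
      exact ⟨Finset.subset_univ _, rfl⟩
    · intro F hF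
      rw [Fintype.mem_piFinset] at hF
      refine Finset.mem_filter.2 ⟨Finset.mem_univ _, ?_⟩
      ext a
      by_cases ha : a ∈ n.support
      · rw [hcount _ ⟨a, ha⟩, ← (Finset.mem_powersetCard.1 (hF ⟨a, ha⟩)).2]
        congr 1
        ext k
        simp
      · rw [Finsupp.notMem_support_iff.1 fun h => ha (hp h), Finsupp.finsetSum_apply]
        refine Finset.sum_eq_zero fun i _ => ?_
        rw [Finsupp.single_apply, if_neg]
        rintro rfl
        exact ha i.1.2
    · intro A _
      ext ⟨a, k⟩
      simp
    · intro F _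
      funext a
      ext k
      simp
  rw [hcard, Finsupp.prod_of_support_subset p hp _ fun _ _ => Nat.factorial_zero,
    Finsupp.prod_of_support_subset q hq _ fun _ _ => Nat.factorial_zero, Finsupp.prod,
    Finset.prod_coe_sort n.support fun a => (n a).choose (p a), ← Finset.prod_mul_distrib,
    ← Finset.prod_mul_distrib]
  refine Finset.prod_congr rfl fun a _ => ?_
  have h1 : n a = p a + q a := by rw [← hpq, Finsupp.add_apply]
  rw [h1, ← mul_assoc]
  simpa using Nat.choose_mul_factorial_mul_factorial (Nat.le_add_right (p a) (q a))

end Types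

section Model

variable {R : ℕ} {S : Type*} {W : S → Type*} [∀ a, Fintype (W a)]

theorem graphSum_eq_of_typeCount (B : ∀ a, Bubble (Fin R) (W a)) (N : ℕ) {J : Type*} [Fintype J]
    (t : J → S) {n : S →₀ ℕ} (hn : typeCount t = n) :
    graphSum B N t = graphSum B N (labelType n) := by
  obtain ⟨e, he⟩ := exists_relabel t hn
  obtain rfl : (fun j => labelType n (e j)) = t := funext he
  exact graphSum_relabel B N (labelType n) e

theorem connectedSum_eq_of_typeCount (B : ∀ a, Bubble (Fin R) (W a)) (N : ℕ) {J : Type*}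
    [Fintype J] (t : J → S) {n : S →₀ ℕ} (hn : typeCount t = n) :
    connectedSum B N t = connectedSum B N (labelType n) := by
  obtain ⟨e, he⟩ := exists_relabel t hn
  obtain rfl : (fun j => labelType n (e j)) = t := funext he
  exact connectedSum_relabel B N (labelType n) e

/-- The product of the factorials of the exponents of a monomial. -/
noncomputable def multiFactorial (n : S →₀ ℕ) : ℝ := n.prod fun _ k => (k.factorial : ℝ)

theorem multiFactorial_ne_zero (n : S →₀ ℕ) : multiFactorial n ≠ 0 :=
  Finset.prod_ne_zero_iff.2 fun a _ => by positivity

theorem coeff_partitionFunction (B : ∀ a, Bubble (Fin R) (W a)) {N : ℕ} (hN : 1 ≤ N)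
    (n : S →₀ ℕ) : MvPowerSeries.coeff n (partitionFunction B N) =
      graphSum B N (labelType n) / multiFactorial n := by
  rw [graphSum, ← integral_prod_traceInvariant hN, ← MeasureTheory.integral_div]
  change MeasureTheory.integral _ _ = _
  congr 1
  funext T
  rw [prod_labels n fun a => -(enhancedCoupling B N 1 a * traceInvariant (B a) T)]
  exact Finset.prod_div_distrib _ _

/-- Minus the free energy: the exponential generating series of the connected graphs. -/
noncomputable def connectedSeries (B : ∀ a, Bubble (Fin R) (W a)) (N : ℕ) : MvPowerSeries S ℝ :=
  fun n => connectedSum B N (labelType n) / multiFactorial n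

theorem coeff_connectedSeries (B : ∀ a, Bubble (Fin R) (W a)) (N : ℕ) (n : S →₀ ℕ) :
    MvPowerSeries.coeff n (connectedSeries B N) =
      connectedSum B N (labelType n) / multiFactorial n := rfl

theorem constantCoeff_connectedSeries (B : ∀ a, Bubble (Fin R) (W a)) (N : ℕ) :
    MvPowerSeries.constantCoeff (connectedSeries B N) = 0 := by
  classical
  rw [← MvPowerSeries.coeff_zero_eq_constantCoeff, coeff_connectedSeries, connectedSum,
    Finset.sum_eq_zero, zero_div]
  intro G hG
  -- There are no interaction vertices, hence no component.
  obtain ⟨-, ⟨x⟩⟩ := G.isConnected_iff.1 (Finset.mem_filter.1 hG).2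
  obtain ⟨⟨⟨a, ha⟩, k⟩, -⟩ := Quot.exists_rep x
  simp at ha

theorem graphSum_zero (B : ∀ a, Bubble (Fin R) (W a)) {N : ℕ} (hN : 1 ≤ N) :
    graphSum B N (labelType 0) = 1 := by
  have : IsEmpty (Labels (0 : S →₀ ℕ)) := ⟨by rintro ⟨⟨a, ha⟩, k⟩; simp at ha⟩
  have : MeasureTheory.IsProbabilityMeasure (gaussianTensor R N) := by
    unfold gaussianTensor
    infer_instance
  rw [graphSum, ← integral_prod_traceInvariant hN]
  simp

/-- The exponential formula: the exponential of the series of the connected graphs is the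
partition function. -/
theorem subst_connectedSeries (B : ∀ a, Bubble (Fin R) (W a)) {N : ℕ} (hN : 1 ≤ N) :
    PowerSeries.subst (connectedSeries B N) (PowerSeries.exp ℝ) = partitionFunction B N := by
  classical
  rw [subst_exp_eq_iff _ _ (constantCoeff_connectedSeries B N)]
  constructor
  · rw [coeff_partitionFunction B hN, graphSum_zero B hN]
    simp [multiFactorial]
  · intro n
    have h := card_mul_graphSum B N (labelType n)
    let cnt : Finset (Labels n) → S →₀ ℕ := fun A => ∑ i ∈ A, Finsupp.single (labelType n i) 1
    have hcnt : ∀ A, cnt A + cnt Aᶜ = n := fun A => sum_single_labels n A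
    have h1 : ∀ A : Finset (Labels n), (A.card : ℝ) *
        (connectedSum B N (fun i : {i // i ∈ A} => labelType n i) *
          graphSum B N fun i : {i // i ∉ A} => labelType n i) =
        (cnt A).degree * (connectedSum B N (labelType (cnt A)) *
          graphSum B N (labelType (cnt Aᶜ))) := by
      intro A
      have hA : typeCount (fun i : {i // i ∈ A} => labelType n i) = cnt A :=
        Finset.sum_coe_sort A fun i => Finsupp.single (labelType n i) 1
      have hA' : typeCount (fun i : {i // i ∉ A} => labelType n i) = cnt Aᶜ := by
        rw [typeCount]
        exact (Finset.sum_subtype Aᶜ (fun x => Finset.mem_compl)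
          fun i => Finsupp.single (labelType n i) 1).symm
      have hdeg : (cnt A).degree = A.card := by
        rw [← hA, degree_typeCount, Fintype.card_coe]
      rw [hdeg, ← connectedSum_eq_of_typeCount B N _ hA, ← graphSum_eq_of_typeCount B N _ hA']
    rw [card_labels, Finset.sum_congr rfl fun A _ => h1 A,
      ← Finset.sum_fiberwise_of_maps_to (g := fun A => (cnt A, cnt Aᶜ))
        (t := Finset.HasAntidiagonal.antidiagonal n)
        fun A _ => Finset.HasAntidiagonal.mem_antidiagonal.2 (hcnt A)] at h
    rw [coeff_partitionFunction B hN, mul_div_assoc', h, Finset.sum_div]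
    refine Finset.sum_congr rfl fun p hp => ?_
    have hpn := Finset.HasAntidiagonal.mem_antidiagonal.1 hp
    have hfilter : (Finset.univ.filter fun A => (cnt A, cnt Aᶜ) = p) =
        Finset.univ.filter fun A => cnt A = p.1 := by
      ext A
      simp only [Finset.mem_filter, Finset.mem_univ, true_and]
      refine ⟨fun h => by rw [← h], fun h => Prod.ext h ?_⟩
      have := (hcnt A).trans hpn.symm
      rw [h] at this
      exact add_left_cancel this
    have hterm : ∀ A ∈ Finset.univ.filter fun A => (cnt A, cnt Aᶜ) = p,
        ((cnt A).degree : ℝ) * (connectedSum B N (labelType (cnt A)) *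
          graphSum B N (labelType (cnt Aᶜ))) =
        p.1.degree * (connectedSum B N (labelType p.1) * graphSum B N (labelType p.2)) := by
      intro A hA
      rw [← (Finset.mem_filter.1 hA).2]
    have hfac : ((Finset.univ.filter fun A => cnt A = p.1).card : ℝ) *
        (multiFactorial p.1 * multiFactorial p.2) = multiFactorial n := by
      have := card_subsets_mul_factorial n p.1 p.2 hpn
      simp only [multiFactorial, Finsupp.prod]
      simp only [Finsupp.prod] at this
      exact_mod_cast this
    have hp1 := multiFactorial_ne_zero p.1
    have hp2 := multiFactorial_ne_zero p.2
    have hn0 := multiFactorial_ne_zero n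
    rw [Finset.sum_congr rfl hterm, Finset.sum_const, hfilter, nsmul_eq_mul,
      coeff_connectedSeries, coeff_partitionFunction B hN, div_eq_iff hn0, ← hfac]
    field_simp

theorem isFreeEnergy_iff (B : ∀ a, Bubble (Fin R) (W a)) {N : ℕ} (hN : 1 ≤ N)
    (F : MvPowerSeries S ℝ) : IsFreeEnergy B N F ↔ F = -connectedSeries B N := by
  have h0 := constantCoeff_connectedSeries B N
  constructor
  · rintro ⟨hF, h⟩
    rw [← subst_connectedSeries B hN] at h
    rw [← subst_exp_injective (by rw [map_neg, hF, neg_zero]) h0 h, neg_neg]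
  · rintro rfl
    exact ⟨by rw [map_neg, h0, neg_zero], by rw [neg_neg, subst_connectedSeries B hN]⟩

/-! ### The large `N` expansion -/

open scoped Classical in
theorem coeff_freeEnergyCoeff (B : ∀ a, Bubble (Fin R) (W a)) (l : ℕ) (n : S →₀ ℕ) :
    MvPowerSeries.coeff n (freeEnergyCoeff B l) =
      -(∏ _i : Labels n, (-1 : ℝ)) / multiFactorial n *
        ∑ G : FeynmanGraph B (labelType n) with G.IsConnected, if G.ell = l then 1 else 0 := by
  have h1 : (n.prod fun _ k => (-1 : ℝ) ^ k / k.factorial) =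
      (∏ _i : Labels n, (-1 : ℝ)) / multiFactorial n := by
    rw [prod_labels n fun _ => (-1 : ℝ)]
    exact Finset.prod_div_distrib _ _
  change -(n.prod fun _ k => (-1 : ℝ) ^ k / k.factorial) * (Nat.card {G : FeynmanGraph B
    (labelType n) // G.IsConnected ∧ G.ell = l} : ℝ) = _
  rw [h1, Nat.card_eq_fintype_card, Fintype.card_subtype, Finset.sum_boole, Finset.filter_filter,
    neg_div]

/-- The values of `ℓ` of the finitely many connected graphs with given interaction vertices. -/
theorem exists_finset_ell (hR : 2 ≤ R) (B : ∀ a, Bubble (Fin R) (W a)) (n : S →₀ ℕ) :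
    ∃ s : Finset ℕ, ∀ G : FeynmanGraph B (labelType n), G.IsConnected → ∃ l ∈ s, G.ell = l := by
  classical
  have h : ∀ G : FeynmanGraph B (labelType n), ∃ l : ℕ, G.IsConnected → G.ell = l := by
    intro G
    by_cases hG : G.IsConnected
    · obtain ⟨l, hl⟩ := G.exists_ell_eq_natCast hR hG
      exact ⟨l, fun _ => hl⟩
    · exact ⟨0, fun h => absurd h hG⟩
  choose L hL using h
  exact ⟨Finset.univ.image L, fun G hG =>
    ⟨L G, Finset.mem_image_of_mem _ (Finset.mem_univ _), hL G hG⟩⟩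

theorem coeff_freeEnergyCoeff_eq_zero {B : ∀ a, Bubble (Fin R) (W a)} {n : S →₀ ℕ} {s : Finset ℕ}
    (hs : ∀ G : FeynmanGraph B (labelType n), G.IsConnected → ∃ l ∈ s, G.ell = l) {l : ℕ}
    (hl : l ∉ s) : MvPowerSeries.coeff n (freeEnergyCoeff B l) = 0 := by
  classical
  rw [coeff_freeEnergyCoeff, Finset.sum_eq_zero, mul_zero]
  intro G hG
  obtain ⟨l', hl', h⟩ := hs G (Finset.mem_filter.1 hG).2
  rw [if_neg]
  intro h'
  rw [h, Nat.cast_inj] at h'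
  exact hl (h' ▸ hl')

theorem hasSum_freeEnergyCoeff (hR : 2 ≤ R) (B : ∀ a, Bubble (Fin R) (W a)) {N : ℕ} (hN : 1 ≤ N)
    (n : S →₀ ℕ) :
    HasSum (fun l : ℕ => (N : ℝ) ^ ((R : ℝ) - l / ((R : ℝ) - 1)) *
      MvPowerSeries.coeff n (freeEnergyCoeff B l))
      (MvPowerSeries.coeff n (-connectedSeries B N)) := by
  classical
  obtain ⟨s, hs⟩ := exists_finset_ell hR B n
  have h1 : MvPowerSeries.coeff n (-connectedSeries B N) =
      ∑ l ∈ s, (N : ℝ) ^ ((R : ℝ) - l / ((R : ℝ) - 1)) *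
        MvPowerSeries.coeff n (freeEnergyCoeff B l) := by
    simp only [coeff_freeEnergyCoeff, Finset.mul_sum]
    rw [Finset.sum_comm, map_neg, coeff_connectedSeries, connectedSum, Finset.sum_div,
      ← Finset.sum_neg_distrib]
    refine Finset.sum_congr rfl fun G hG => ?_
    obtain ⟨l, hl, h⟩ := hs G (Finset.mem_filter.1 hG).2
    rw [Finset.sum_eq_single_of_mem l hl, if_pos h, G.amplitude_eq_rpow hR hN, h]
    · simp only [Pi.one_apply]
      ring
    · intro l' _ hne
      rw [if_neg, mul_zero, mul_zero]
      rw [h, Nat.cast_inj]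
      exact hne.symm
  rw [h1]
  refine hasSum_sum_of_ne_finset_zero fun l hl => ?_
  rw [coeff_freeEnergyCoeff_eq_zero hs hl, mul_zero]

end Model

end TensorModel

theorem mainTheorem1 (R : ℕ) (hR : 2 ≤ R) {S : Type*} {W : S → Type*} [∀ a, Fintype (W a)]
    (B : ∀ a, Bubble (Fin R) (W a)) :
    (∀ {I : Type*} [Fintype I] (t : I → S) (G : FeynmanGraph B t), G.IsConnected →
      G.ell = 2 * G.bubble.index + R * ((R : ℝ) - 1) *
          (1 + ∑ i, (((B (t i)).numComponents : ℝ) - 1) - G.bubble.numComponents) ∧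
      0 ≤ G.ell ∧
      (∃ l : ℕ, G.ell = l) ∧
      (R : ℝ) - G.ell / ((R : ℝ) - 1) ≤ R ∧
      ∀ (N : ℕ) (lam : S → ℝ), 1 ≤ N →
        G.amplitude N lam = (∏ i, -lam (t i)) * (N : ℝ) ^ ((R : ℝ) - G.ell / ((R : ℝ) - 1))) ∧
    (∀ n : S →₀ ℕ, {l : ℕ | MvPowerSeries.coeff n (freeEnergyCoeff B l) ≠ 0}.Finite) ∧
    ∀ N : ℕ, 1 ≤ N →
      (∃! F : MvPowerSeries S ℝ, IsFreeEnergy B N F) ∧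
      ∀ F : MvPowerSeries S ℝ, IsFreeEnergy B N F → ∀ n : S →₀ ℕ,
        HasSum (fun l : ℕ => (N : ℝ) ^ ((R : ℝ) - l / ((R : ℝ) - 1)) *
          MvPowerSeries.coeff n (freeEnergyCoeff B l)) (MvPowerSeries.coeff n F) := by
  refine ⟨fun t G hG => ?_, fun n => ?_, fun N hN => ⟨?_, ?_⟩⟩
  · have h0 := G.ell_nonneg hR hG
    have hR' : (2 : ℝ) ≤ R := by exact_mod_cast hR
    have h1 : 0 ≤ G.ell / ((R : ℝ) - 1) := div_nonneg h0 (by linarith)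
    exact ⟨G.ell_eq hR, h0, G.exists_ell_eq_natCast hR hG, by linarith,
      fun N lam hN => G.amplitude_eq_rpow hR hN lam⟩
  · obtain ⟨s, hs⟩ := exists_finset_ell hR B n
    refine s.finite_toSet.subset fun l hl => ?_
    by_contra h
    exact hl (coeff_freeEnergyCoeff_eq_zero hs h)
  · exact ⟨_, (isFreeEnergy_iff B hN _).2 rfl, fun F hF => (isFreeEnergy_iff B hN F).1 hF⟩
  · intro F hF n
    rw [(isFreeEnergy_iff B hN F).1 hF]
    exact hasSum_freeEnergyCoeff hR B hN n
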